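/- Let $k$ be a field. For a quiver with monomial relations, letters are the arrows and their formal inverses; a word $l_1\cdots l_n$ is a sequence of letters with $s(l_i)=t(l_{i+1})$ and $l_i^{-1}\neq l_{i+1}$, such that neither it nor its inverse contains a relation as a subword (paths are composed like maps: $\gamma\alpha$ means first $\alpha$, then $\gamma$). A word $w$ is cyclic if it contains direct and inverse letters and $ww$ is a word. A pair $(v,v')$ of words is attracting if, with $a$ the last letter of $v$ and $b$ the first letter of $v'$, one has $s(a)=t(b)$ and the letters $a$ and $b^{-1}$ are different but are both direct or both inverse. Let $w=l_1\cdots l_n=u_1v_1\cdots u_{2t}v_{2t}$ be a cyclic word in which no letter occurs twice, with words $u_i,v_i$ of length at least $1$, and let $\sigma$ be an involution on $\{1,\dots,2t\}$ such that: each $v_i$ consists of direct letters only or of inverse letters only, and $v_i=v_{\sigma(i)}^{-1}$; every edge $\{l,l^{-1}\}$ appearing in some $u_i$ occurs once in $w$, and every edge appearing in some $v_i$ occurs twice in $w$; the pairs $(v_i,u_{i+1})$ are attracting and the pairs $(u_i,v_i)$ are not attracting (with $u_{2t+1}=u_1$). The wind wheel algebra $W=W(w)$ with $t$ bars is the following quotient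 of a path algebra over $k$. Take the quiver with vertices $a_0,\dots,a_{n-1}$ ($a_n=a_0$) and arrows $\alpha_1,\dots,\alpha_n$, where $\alpha_p: a_p\to a_{p-1}$ if $l_p$ is direct and $\alpha_p:a_{p-1}\to a_p$ if $l_p$ is inverse; identify, for all $i$, the path $v_i$ with the path $v_{\sigma(i)}^{-1}$ (vertices and arrows); and impose, for every $i$ such that $v_i$ is direct and $j=\sigma(i)$, the zero relations $$u_{i,\omega}\,u_{j+1,1},\qquad (u_{i+1,1})^{-1}(u_{j,\omega})^{-1},\qquad u_{i,\omega}\,v_i\,(u_{j,\omega})^{-1},$$ where $u_{i,1}$ and $u_{i,\omega}$ denote the first and the last letter of $u_i$. For $\lambda\in k\setminus\{0\}$ let $M=M(w,\lambda)$ be the band module: the $W$-module with $k$-basis $e_0,\dots,e_{n-1}$ ($e_n=e_0$), where $e_p$ lies at the vertex $a_p$, and where an arrow $\alpha$ of $W$ acts as the sum, over all $p$ with $l_p\in\{\alpha,\alpha^{-1}\}$, of the maps $e_p\mapsto c_p e_{p-1}$ (if $l_p=\alpha$) or $e_{p-1}\mapsto c_p e_p$ (if $l_p=\alpha^{-1}$),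 all other basis vectors being sent to $0$; here $c_1=\lambda$ and $c_p=1$ for $p\ge 2$. Then the endomorphism ring $E=\operatorname{End}_W(M)$ is a radical square zero algebra with radical of dimension $t$, that is, its Jacobson radical $J$ satisfies $J^2=0$ and $\dim_k J=t$; and the only endomorphism of $M$ with semisimple image is the zero endomorphism. -/

import Mathlib

namespace WindWheels

universe uV uA uk

/-- A quiver, given by its vertices, its arrows, and the starting point `s α` and the terminal
point `t α` of every arrow `α`. Paths are written from right to left, as for composition of maps:
`γ α` is a path when `s γ = t α`. -/
structure Quiv where
  V : Type uV
  A : Type uA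
  s : A → V
  t : A → V

/-! ### Words -/

/-- The letters for a quiver: `⟨α, true⟩` is the arrow `α` (a direct letter), `⟨α, false⟩` is its
formal inverse (an inverse letter). -/
@[ext]
structure Letter (Q : Quiv.{uV, uA}) where
  arrow : Q.A
  dir : Bool

namespace Letter

variable {Q : Quiv.{uV, uA}}

def inv (l : Letter Q) : Letter Q := ⟨l.arrow, !l.dir⟩

/-- Starting point of a letter. -/
def src (l : Letter Q) : Q.V := if l.dir = true then Q.s l.arrow else Q.t l.arrow

/-- Terminal point of a letter. -/
def tgt (l : Letter Q) : Q.V := if l.dir = true then Q.t l.arrow else Q.s l.arrow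

end Letter

section Words

variable {Q : Quiv.{uV, uA}}

/-- The inverse `l_n⁻¹ ⋯ l_1⁻¹` of `l_1 ⋯ l_n`. -/
def invWord (w : List (Letter Q)) : List (Letter Q) := (w.map Letter.inv).reverse

def IsDirect (w : List (Letter Q)) : Prop := ∀ l ∈ w, l.dir = true

def IsInverse (w : List (Letter Q)) : Prop := ∀ l ∈ w, l.dir = false

def IsSerial (w : List (Letter Q)) : Prop := IsDirect w ∨ IsInverse w

/-- `w = l_1 ⋯ l_n` is a word of length `n ≥ 1` for the quiver `Q` with the monomial relations `ρ`
(every relation is a path, written as the list of its arrows): it is a path in the quiver with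
formal inverses, it is reduced, and no relation is a subword of `w` or of its inverse. -/
structure IsWord (ρ : Set (List Q.A)) (w : List (Letter Q)) : Prop where
  ne_nil : w ≠ []
  path : w.IsChain (fun l l' => l.src = l'.tgt)
  reduced : w.IsChain (fun l l' => l.inv ≠ l')
  no_rel : ∀ r ∈ ρ, ¬ (r.map fun α => (⟨α, true⟩ : Letter Q)) <:+: w ∧
    ¬ (r.map fun α => (⟨α, true⟩ : Letter Q)) <:+: invWord w

/-- Cyclic words: words `w` containing both direct and inverse letters such that `w w` is a word. -/
structure IsCyclicWord (ρ : Set (List Q.A)) (w : List (Letter Q)) : Prop where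
  word : IsWord ρ w
  exists_direct : ∃ l ∈ w, l.dir = true
  exists_inverse : ∃ l ∈ w, l.dir = false
  square : IsWord ρ (w ++ w)

/-- The pair `(v, w)` is attracting: with `a` the last letter of `v` and `b` the first letter of
`w`, the starting point of `a` is the terminal point of `b`, and `a`, `b⁻¹` are different but have
the same direction. -/
def Attracting (v w : List (Letter Q)) : Prop :=
  ∃ a ∈ v.getLast?, ∃ b ∈ w.head?, a.src = b.tgt ∧ a ≠ b.inv ∧ a.dir = b.inv.dir

end Words

/-- The cyclic successor in `{0, …, n - 1}`. -/
def cyc {n : ℕ} (p : Fin n) : Fin n := ⟨(p.val + 1) % n, Nat.mod_lt _ p.pos⟩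

/-! ### Wind wheel words -/

/-- The data defining a wind wheel algebra: a cyclic word `w` without repetition for a quiver `Q`
with monomial relations `ρ`, with its factorization `w = u_1 v_1 ⋯ u_{2t} v_{2t}` and the
involution `σ`; the indices `1, …, 2t` are here the elements of `Fin (2 * t)`, and `cyc i` is the
index following `i` cyclically. -/
structure WindWheel (Q : Quiv.{uV, uA}) (ρ : Set (List Q.A)) where
  w : List (Letter Q)
  cyclic : IsCyclicWord ρ w
  nodup : w.Nodup
  t : ℕ
  u : Fin (2 * t) → List (Letter Q)
  v : Fin (2 * t) → List (Letter Q)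
  u_ne : ∀ i, u i ≠ []
  v_ne : ∀ i, v i ≠ []
  w_eq : w = (List.ofFn fun i => u i ++ v i).flatten
  σ : Fin (2 * t) → Fin (2 * t)
  σ_invol : Function.Involutive σ
  v_serial : ∀ i, IsSerial (v i)
  v_inv : ∀ i, v i = invWord (v (σ i))
  u_once : ∀ i, ∀ l ∈ u i, {p : Fin w.length | (w.get p).arrow = l.arrow}.ncard = 1
  v_twice : ∀ i, ∀ l ∈ v i, {p : Fin w.length | (w.get p).arrow = l.arrow}.ncard = 2
  attr_vu : ∀ i, Attracting (v i) (u (cyc i))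
  not_attr_uv : ∀ i, ¬ Attracting (u i) (v i)

/-! ### Cycle quivers and barification -/

/-- The quiver of the hereditary algebra `H(ε(w))` of type `Ã`, for `w = l_1 ⋯ l_n`, has the vertices
`a_0, …, a_{n-1}` (with `a_n = a_0`) and the arrows `α_1, …, α_n`, where `α_{p+1}` is
`a_{p+1} → a_p` if `l_{p+1}` is direct and `a_p → a_{p+1}` otherwise. Here an element `p` of `Fin n`
stands both for the vertex `a_p` and for the arrow `α_{p+1}`; `cycleS w p` is the starting point of
this arrow. -/
def cycleS {Q : Quiv.{uV, uA}} (w : List (Letter Q)) (p : Fin w.length) : Fin w.length :=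
  if (w.get p).dir = true then cyc p else p

/-- The terminal point of the arrow `α_{p+1}`. -/
def cycleT {Q : Quiv.{uV, uA}} (w : List (Letter Q)) (p : Fin w.length) : Fin w.length :=
  if (w.get p).dir = true then p else cyc p

/-- Identification of arrows: the arrows of the cycle quiver at the positions of two mutually
inverse letters of `w` are identified. For a wind wheel these are the pairs of corresponding
letters in `v_i` and `v_{σ(i)}⁻¹`. -/
def GlueA {Q : Quiv.{uV, uA}} (w : List (Letter Q)) (p q : Fin w.length) : Prop :=
  w.get p = (w.get q).inv

/-- The corresponding identification of vertices: if `l_{p+1} = l_{q+1}⁻¹`, then `a_p` is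
identified with `a_{q+1}` (and, exchanging `p` and `q`, `a_{p+1}` with `a_q`). -/
def GlueV {Q : Quiv.{uV, uA}} (w : List (Letter Q)) (a b : Fin w.length) : Prop :=
  ∃ p q : Fin w.length, w.get p = (w.get q).inv ∧ a = p ∧ b = cyc q

lemma glue_s {Q : Quiv.{uV, uA}} {w : List (Letter Q)} {p q : Fin w.length} (h : GlueA w p q) :
    Quot.mk (GlueV w) (cycleS w p) = Quot.mk (GlueV w) (cycleS w q) := by
  have h0 : w.get p = (w.get q).inv := h
  have h' : w.get q = (w.get p).inv := by rw [h0]; simp [Letter.inv]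
  have hd : (w.get p).dir = !(w.get q).dir := by rw [h0]; rfl
  unfold cycleS
  cases hq : (w.get q).dir
  · rw [if_pos (by rw [hd, hq]; rfl), if_neg (by decide)]
    exact (Quot.sound ⟨q, p, h', rfl, rfl⟩).symm
  · rw [if_neg (by rw [hd, hq]; decide), if_pos rfl]
    exact Quot.sound ⟨p, q, h0, rfl, rfl⟩

lemma glue_t {Q : Quiv.{uV, uA}} {w : List (Letter Q)} {p q : Fin w.length} (h : GlueA w p q) :
    Quot.mk (GlueV w) (cycleT w p) = Quot.mk (GlueV w) (cycleT w q) := by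
  have h0 : w.get p = (w.get q).inv := h
  have h' : w.get q = (w.get p).inv := by rw [h0]; simp [Letter.inv]
  have hd : (w.get p).dir = !(w.get q).dir := by rw [h0]; rfl
  unfold cycleT
  cases hq : (w.get q).dir
  · rw [if_pos (by rw [hd, hq]; rfl), if_neg (by decide)]
    exact Quot.sound ⟨p, q, h0, rfl, rfl⟩
  · rw [if_neg (by rw [hd, hq]; decide), if_pos rfl]
    exact (Quot.sound ⟨q, p, h', rfl, rfl⟩).symm

namespace WindWheel

variable {Q : Quiv.{uV, uA}} {ρ : Set (List Q.A)} (D : WindWheel Q ρ)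

/-- The quiver of the wind wheel algebra `W(w)`: the cycle quiver of `w` with the paths `v_i` and
`v_{σ(i)}⁻¹` identified, for all `i`. -/
def quiv : Quiv.{0, 0} where
  V := Quot (GlueV D.w)
  A := Quot (GlueA D.w)
  s := Quot.lift (fun p => Quot.mk _ (cycleS D.w p)) (fun _ _ h => glue_s h)
  t := Quot.lift (fun p => Quot.mk _ (cycleT D.w p)) (fun _ _ h => glue_t h)

/-- The vertex of `W(w)` given by the vertex `a_p` of the cycle quiver. -/
def vtx (p : Fin D.w.length) : D.quiv.V := Quot.mk _ p

/-- The arrow of `W(w)` given by the arrow `α_{p+1}` of the cycle quiver. -/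
def arr (p : Fin D.w.length) : D.quiv.A := Quot.mk _ p

instance : Finite D.quiv.V := Finite.of_surjective D.vtx Quot.mk_surjective

/-- The arrow of `Q` that an arrow of `W(w)` stems from. -/
def label : D.quiv.A → Q.A :=
  Quot.lift (fun p => (D.w.get p).arrow) (by
    intro p q (h : D.w.get p = (D.w.get q).inv)
    simp only [h, Letter.inv])

/-- The arrow underlying the last letter `u_{i,ω}` of `u_i`. -/
def uLast (i : Fin (2 * D.t)) : Q.A := ((D.u i).getLast (D.u_ne i)).arrow

/-- The arrow underlying the first letter `u_{i,1}` of `u_i`. -/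
def uFirst (i : Fin (2 * D.t)) : Q.A := ((D.u i).head (D.u_ne i)).arrow

/-- The relations of `W(w)`, as paths in the quiver of `W(w)` (an arrow of which is recognized by
its label): for `v_i` direct and `j = σ(i)`, the letters `u_{i,ω}` and `u_{j+1,1}` are direct and
`u_{i+1,1}` and `u_{j,ω}` are inverse, and the relations are
`u_{i,ω} u_{j+1,1}`, `(u_{i+1,1})⁻¹ (u_{j,ω})⁻¹` and `u_{i,ω} v_i (u_{j,ω})⁻¹`. -/
def rel : Set (List D.quiv.A) :=
  {r | ∃ i, IsDirect (D.v i) ∧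
    (r.map D.label = [D.uLast i, D.uFirst (cyc (D.σ i))] ∨
     r.map D.label = [D.uFirst (cyc i), D.uLast (D.σ i)] ∨
     r.map D.label = D.uLast i :: ((D.v i).map Letter.arrow ++ [D.uLast (D.σ i)]))}

/-! ### Positions of the subwords `u_i`, `v_i` in `w`

These facts serve only to show that the relations of `W(w)` vanish on the band modules. -/

/-- The position in `w` at which `u_i` begins. -/
def off (m : ℕ) : ℕ := (((List.ofFn fun i => D.u i ++ D.v i).take m).flatten).length

/-- The vertices of the cycle quiver on the path `v_i`. -/
def vSet (i : Fin (2 * D.t)) : Set (Fin D.w.length) :=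
  {p | ∃ r ≤ (D.v i).length, p.val = (D.off i + (D.u i).length + r) % D.w.length}

lemma off_zero : D.off 0 = 0 := by simp [off]

lemma off_succ (i : Fin (2 * D.t)) :
    D.off (i.val + 1) = D.off i + (D.u i).length + (D.v i).length := by
  simp [off, List.take_add_one, add_assoc]

lemma off_end : D.off (2 * D.t) = D.w.length := by
  conv_rhs => rw [D.w_eq]
  unfold off
  rw [List.take_of_length_le (by simp)]

lemma off_mono {a b : ℕ} (h : a ≤ b) : D.off a ≤ D.off b := by
  unfold off
  have : (List.ofFn fun i => D.u i ++ D.v i).take a =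
      ((List.ofFn fun i => D.u i ++ D.v i).take b).take a := by
    rw [List.take_take, min_eq_left h]
  rw [this]
  conv_rhs => rw [← List.take_append_drop a
    ((List.ofFn fun i => D.u i ++ D.v i).take b), List.flatten_append, List.length_append]
  omega

lemma off_le (i : Fin (2 * D.t)) :
    D.off i + (D.u i).length + (D.v i).length ≤ D.w.length := by
  rw [← off_succ, ← off_end]
  exact D.off_mono i.isLt

lemma u_pos (i : Fin (2 * D.t)) : 0 < (D.u i).length := List.length_pos_iff.2 (D.u_ne i)

lemma v_pos (i : Fin (2 * D.t)) : 0 < (D.v i).length := List.length_pos_iff.2 (D.v_ne i)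

lemma w_get (i : Fin (2 * D.t)) (r : ℕ) (hr : r < (D.u i ++ D.v i).length) :
    D.w[D.off i + r]? = some ((D.u i ++ D.v i)[r]) := by
  have h1 : D.w = (((List.ofFn fun i => D.u i ++ D.v i).take i).flatten ++
      ((D.u i ++ D.v i) ++ ((List.ofFn fun i => D.u i ++ D.v i).drop (i + 1)).flatten)) := by
    conv_lhs => rw [D.w_eq, ← List.take_append_drop i (List.ofFn fun i => D.u i ++ D.v i)]
    rw [List.flatten_append, List.drop_eq_getElem_cons (by simp)]
    simp
  rw [h1, List.getElem?_append_right (by simp [off])]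
  rw [show D.off i + r - (((List.ofFn fun i => D.u i ++ D.v i).take i).flatten).length = r by
    simp only [off]; omega]
  rw [List.getElem?_append_left hr, List.getElem?_eq_getElem hr]

lemma infix_w (i : Fin (2 * D.t)) : D.u i ++ D.v i <:+: D.w := by
  rw [D.w_eq]
  exact List.infix_of_mem_flatten (List.mem_ofFn.2 ⟨i, rfl⟩)

lemma vSet_disj {i j : Fin (2 * D.t)} {p : Fin D.w.length} (hi : p ∈ D.vSet i)
    (hj : p ∈ D.vSet j) : i = j := by
  obtain ⟨r, hr, h⟩ := hi
  obtain ⟨r', hr', h'⟩ := hj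
  have a1 := D.off_le i
  have a2 := D.off_le j
  have a3 := D.u_pos i
  have a4 := D.u_pos j
  have key : D.off i + (D.u i).length + r = D.off j + (D.u j).length + r' := by
    have aux : ∀ n x : ℕ, 0 < x → x ≤ n → (x % n = x ∧ x < n) ∨ (x % n = 0 ∧ x = n) := by
      intro n x hx hn
      rcases hn.lt_or_eq with h | h
      · exact Or.inl ⟨Nat.mod_eq_of_lt h, h⟩
      · exact Or.inr ⟨by rw [h, Nat.mod_self], h⟩
    have b1 := aux D.w.length (D.off i + (D.u i).length + r) (by omega) (by omega)
    have b2 := aux D.w.length (D.off j + (D.u j).length + r') (by omega) (by omega)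
    omega
  have c1 := D.off_succ i
  have c2 := D.off_succ j
  rcases lt_trichotomy i.val j.val with h | h | h
  · have := D.off_mono (Nat.succ_le_of_lt h)
    simp only [Nat.succ_eq_add_one] at this
    omega
  · exact Fin.ext h
  · have := D.off_mono (Nat.succ_le_of_lt h)
    simp only [Nat.succ_eq_add_one] at this
    omega

lemma exists_pos_v {i : Fin (2 * D.t)} {l : Letter Q} (hl : l ∈ D.v i) :
    ∃ p, D.w.get p = l ∧ p ∈ D.vSet i ∧ cyc p ∈ D.vSet i := by
  obtain ⟨r, hr, rfl⟩ := List.getElem_of_mem hl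
  have h1 := D.w_get i ((D.u i).length + r) (by simp; omega)
  have h2 := D.off_le i
  refine ⟨⟨D.off i + ((D.u i).length + r), by omega⟩, ?_, ⟨r, hr.le, ?_⟩, ⟨r + 1, hr, ?_⟩⟩
  · rw [List.getElem?_eq_getElem (by omega), List.getElem_append_right (by omega)] at h1
    simpa using h1
  · rw [Nat.mod_eq_of_lt (by omega)]
    simp only
    omega
  · simp only [cyc]
    congr 1
    omega

lemma inv_mem {i : Fin (2 * D.t)} {l : Letter Q} (hl : l ∈ D.v i) : l.inv ∈ D.v (D.σ i) := by
  rw [D.v_inv, D.σ_invol i]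
  simp only [invWord, List.mem_reverse, List.mem_map]
  exact ⟨l, hl, rfl⟩

lemma pos_v {i : Fin (2 * D.t)} {l : Letter Q} (hl : l ∈ D.v i) {p : Fin D.w.length}
    (hp : (D.w.get p).arrow = l.arrow) :
    (p ∈ D.vSet i ∧ cyc p ∈ D.vSet i) ∨ (p ∈ D.vSet (D.σ i) ∧ cyc p ∈ D.vSet (D.σ i)) := by
  obtain ⟨p₁, h₁, h₁'⟩ := D.exists_pos_v hl
  obtain ⟨p₂, h₂, h₂'⟩ := D.exists_pos_v (D.inv_mem hl)
  have hne : p₁ ≠ p₂ := by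
    rintro rfl
    have h := congrArg Letter.dir (h₁.symm.trans h₂)
    simp [Letter.inv] at h
  have hs : ({p₁, p₂} : Set (Fin D.w.length)) = {p | (D.w.get p).arrow = l.arrow} := by
    refine Set.eq_of_subset_of_ncard_le ?_ ?_ (Set.toFinite _)
    · rintro q (rfl | rfl)
      · exact congrArg Letter.arrow h₁
      · exact (congrArg Letter.arrow h₂ :)
    · rw [D.v_twice i l hl, Set.ncard_pair hne]
  have : p ∈ ({p₁, p₂} : Set (Fin D.w.length)) := hs ▸ hp
  rcases this with rfl | rfl
  · exact Or.inl h₁'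
  · exact Or.inr h₂'

lemma pos_u {i : Fin (2 * D.t)} {l : Letter Q} (hl : l ∈ D.u i) {p q : Fin D.w.length}
    (hp : (D.w.get p).arrow = l.arrow) (hq : (D.w.get q).arrow = l.arrow) : p = q := by
  obtain ⟨a, ha⟩ := Set.ncard_eq_one.1 (D.u_once i l hl)
  have h1 : p ∈ ({a} : Set _) := ha ▸ hp
  have h2 : q ∈ ({a} : Set _) := ha ▸ hq
  rw [h1, h2]

lemma pos_uLast {i : Fin (2 * D.t)} {p : Fin D.w.length}
    (hp : (D.w.get p).arrow = D.uLast i) :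
    D.w.get p = (D.u i).getLast (D.u_ne i) ∧ cyc p ∈ D.vSet i := by
  have h0 := D.u_pos i
  have h1 := D.w_get i ((D.u i).length - 1) (by simp; omega)
  have h2 := D.off_le i
  have h3 : D.off i + ((D.u i).length - 1) < D.w.length := by have := D.v_pos i; omega
  have h4 : D.w.get ⟨D.off i + ((D.u i).length - 1), h3⟩ = (D.u i).getLast (D.u_ne i) := by
    rw [List.getElem?_eq_getElem h3, List.getElem_append_left (by omega)] at h1
    rw [List.getLast_eq_getElem]
    simpa using h1
  have h5 := D.pos_u (List.getLast_mem (D.u_ne i)) hp (congrArg Letter.arrow h4)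
  subst h5
  refine ⟨h4, 0, Nat.zero_le _, ?_⟩
  simp only [cyc]
  congr 1
  omega

lemma pos_uFirst {i : Fin (2 * D.t)} {p : Fin D.w.length}
    (hp : (D.w.get p).arrow = D.uFirst (cyc i)) :
    D.w.get p = (D.u (cyc i)).head (D.u_ne (cyc i)) ∧ p ∈ D.vSet i := by
  have h0 := D.u_pos (cyc i)
  have h1 := D.w_get (cyc i) 0 (by simp; omega)
  have h2 := D.off_le (cyc i)
  have h3 : D.off (cyc i) + 0 < D.w.length := by omega
  have h4 : D.w.get ⟨D.off (cyc i) + 0, h3⟩ = (D.u (cyc i)).head (D.u_ne (cyc i)) := by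
    rw [List.getElem?_eq_getElem h3, List.getElem_append_left (by omega)] at h1
    rw [List.head_eq_getElem]
    simpa using h1
  have h5 := D.pos_u (List.head_mem (D.u_ne (cyc i))) hp (congrArg Letter.arrow h4)
  subst h5
  refine ⟨h4, (D.v i).length, le_rfl, ?_⟩
  rw [← off_succ]
  by_cases hi : i.val + 1 < 2 * D.t
  · have : (cyc i).val = i.val + 1 := Nat.mod_eq_of_lt hi
    rw [this] at h3
    simp only [this]
    rw [Nat.mod_eq_of_lt (by omega)]
    omega
  · have hi' : i.val + 1 = 2 * D.t := by have := i.isLt; omega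
    have : (cyc i).val = 0 := by simp [cyc, hi']
    simp [this, hi', off_zero, off_end]

lemma dir_uLast (i : Fin (2 * D.t)) :
    ((D.u i).getLast (D.u_ne i)).dir = ((D.v i).head (D.v_ne i)).dir := by
  have h := D.not_attr_uv i
  by_contra hd
  apply h
  have h1 := (List.isChain_append.1 (D.cyclic.word.path.infix (D.infix_w i))).2.2
  have h2 := (List.isChain_append.1 (D.cyclic.word.reduced.infix (D.infix_w i))).2.2
  have e1 := List.getLast?_eq_some_getLast (D.u_ne i)
  have e2 := List.head?_eq_some_head (D.v_ne i)
  refine ⟨_, e1, _, e2, h1 _ e1 _ e2, ?_, ?_⟩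
  · intro h3
    apply h2 _ e1 _ e2
    rw [h3]
    simp [Letter.inv]
  · revert hd
    simp only [Letter.inv]
    cases ((D.u i).getLast (D.u_ne i)).dir <;> cases ((D.v i).head (D.v_ne i)).dir <;> simp

lemma dir_uFirst (i : Fin (2 * D.t)) :
    ((D.u (cyc i)).head (D.u_ne (cyc i))).dir = !((D.v i).getLast (D.v_ne i)).dir := by
  obtain ⟨a, ha, b, hb, -, -, h⟩ := D.attr_vu i
  rw [List.getLast?_eq_some_getLast (D.v_ne i)] at ha
  rw [List.head?_eq_some_head (D.u_ne (cyc i))] at hb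
  obtain rfl := Option.some.inj ha
  obtain rfl := Option.some.inj hb
  rw [h]
  simp [Letter.inv]

lemma isInverse_σ {i : Fin (2 * D.t)} (h : IsDirect (D.v i)) : IsInverse (D.v (D.σ i)) := by
  intro l hl
  have h1 := h _ (D.σ_invol i ▸ D.inv_mem hl)
  simpa [Letter.inv] using h1

lemma ne_σ {i : Fin (2 * D.t)} (h : IsDirect (D.v i)) : i ≠ D.σ i := by
  intro e
  have h1 := h _ (List.head_mem (D.v_ne i))
  have h2 := D.isInverse_σ h ((D.v i).head (D.v_ne i)) (by rw [← e]; exact List.head_mem _)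
  simp [h1] at h2

lemma cycle_s_direct {p : Fin D.w.length} (h : (D.w.get p).dir = true) :
    cycleS D.w p = cyc p := if_pos h

lemma cycle_t_direct {p : Fin D.w.length} (h : (D.w.get p).dir = true) :
    cycleT D.w p = p := if_pos h

lemma cycle_s_inverse {p : Fin D.w.length} (h : (D.w.get p).dir = false) :
    cycleS D.w p = p := if_neg (by rw [h]; decide)

lemma cycle_t_inverse {p : Fin D.w.length} (h : (D.w.get p).dir = false) :
    cycleT D.w p = cyc p := if_neg (by rw [h]; decide)

end WindWheel

/-! ### The algebra of a quiver with monomial relations -/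

section Algebra

variable (k : Type uk) [Field k] (Q : Quiv.{uV, uA}) [Finite Q.V] (ρ : Set (List Q.A))

/-- The vertex `x`, as a generator. -/
abbrev gV (x : Q.V) : FreeAlgebra k (Q.V ⊕ Q.A) := FreeAlgebra.ι k (Sum.inl x)

/-- The arrow `α`, as a generator. -/
abbrev gA (α : Q.A) : FreeAlgebra k (Q.V ⊕ Q.A) := FreeAlgebra.ι k (Sum.inr α)

/-- The relations presenting the path algebra of a finite quiver modulo the ideal generated by
`ρ`: the vertices are orthogonal idempotents with sum `1`, the arrow `α` satisfies
`t(α) α = α = α s(α)`, and the paths in `ρ` are zero. -/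
inductive PathRel : FreeAlgebra k (Q.V ⊕ Q.A) → FreeAlgebra k (Q.V ⊕ Q.A) → Prop
  | idem (x : Q.V) : PathRel (gV k Q x * gV k Q x) (gV k Q x)
  | orth (x y : Q.V) (h : x ≠ y) : PathRel (gV k Q x * gV k Q y) 0
  | sum_one : PathRel (∑ᶠ x, gV k Q x) 1
  | tgt (α : Q.A) : PathRel (gV k Q (Q.t α) * gA k Q α) (gA k Q α)
  | src (α : Q.A) : PathRel (gA k Q α * gV k Q (Q.s α)) (gA k Q α)
  | rel (r : List Q.A) (h : r ∈ ρ) : PathRel ((r.map (gA k Q)).prod) 0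

/-- The algebra of the finite quiver `Q` with the monomial relations `ρ`: the path algebra of `Q`
over `k` modulo the two-sided ideal generated by `ρ`, by generators and relations. -/
abbrev PathAlgebra : Type _ := RingQuot (PathRel k Q ρ)

end Algebra

namespace WindWheel

variable (k : Type uk) [Field k] {Q : Quiv.{uV, uA}} {ρ : Set (List Q.A)} (D : WindWheel Q ρ)

/-- The wind wheel algebra `W(w)` over `k`. -/
abbrev algebra : Type _ := PathAlgebra k D.quiv D.rel

/-! ### The band modules `M(w, λ)` -/

variable {k}

/-- The underlying space of `M(w, λ)`: it has a basis `e_0, …, e_{n-1}` (with `e_n = e_0`) where `n`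
is the length of `w`, and `e_p` lies at the vertex `a_p`. -/
@[nolint unusedArguments]
def BandModule (_ : k) : Type uk := Fin D.w.length → k

noncomputable section

instance (c : k) : AddCommGroup (D.BandModule c) := inferInstanceAs (AddCommGroup (Fin _ → k))

instance (c : k) : Module k (D.BandModule c) := inferInstanceAs (Module k (Fin _ → k))

open Classical in
/-- The action of the vertex `x`: the projection onto the span of the `e_p` with `a_p = x`. -/
def vertexMap (c : k) (x : D.quiv.V) : Module.End k (D.BandModule c) :=
  ∑ p : Fin D.w.length, if D.vtx p = x then
    LinearMap.single k (fun _ : Fin D.w.length => k) p ∘ₗ LinearMap.proj p else 0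

open Classical in
/-- The action of the arrow `α`: for any position `p` in `w` at which the letter is `α` or its
inverse, `α` sends `e_{p+1}` to `e_p` in the first case and `e_p` to `e_{p+1}` in the second one,
multiplied by `λ` if this is the first letter of `w`. -/
def arrowMap (c : k) (α : D.quiv.A) : Module.End k (D.BandModule c) :=
  ∑ p : Fin D.w.length, if D.arr p = α then
    (if p.val = 0 then c else 1) •
      (LinearMap.single k (fun _ : Fin D.w.length => k) (cycleT D.w p) ∘ₗ
        LinearMap.proj (cycleS D.w p)) else 0

open Classical in
lemma vertexMap_apply (c : k) (x : D.quiv.V) (f : D.BandModule c) (q : Fin D.w.length) :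
    D.vertexMap c x f q = if D.vtx q = x then f q else 0 := by
  have h : D.vertexMap c x f = ∑ p : Fin D.w.length,
      (if D.vtx p = x then Pi.single p (f p) else 0 : Fin D.w.length → k) := by
    unfold vertexMap
    rw [LinearMap.sum_apply]
    refine Finset.sum_congr rfl fun p _ => ?_
    split_ifs <;> rfl
  rw [h, Finset.sum_apply, Finset.sum_eq_single q]
  · split_ifs <;> simp
  · intro p _ hp
    split_ifs <;> simp [Pi.single_eq_of_ne hp.symm]
  · simp

open Classical in
lemma arrowMap_apply (c : k) (α : D.quiv.A) (f : D.BandModule c) :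
    D.arrowMap c α f = ∑ p : Fin D.w.length,
      (if D.arr p = α then (if p.val = 0 then c else 1) •
        Pi.single (cycleT D.w p) (f (cycleS D.w p)) else 0 :
          Fin D.w.length → k) := by
  unfold arrowMap
  rw [LinearMap.sum_apply]
  refine Finset.sum_congr rfl fun p _ => ?_
  split_ifs <;> rfl

/-- `f` lies in the span of the `e_p` with `p ∈ S`. -/
def SuppIn {c : k} (S : Set (Fin D.w.length)) (f : D.BandModule c) : Prop := ∀ p, p ∉ S → f p = 0

lemma arrowMap_supp {c : k} {α : D.quiv.A} {S T : Set (Fin D.w.length)}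
    (h : ∀ p : Fin D.w.length, (D.w.get p).arrow = D.label α →
      cycleS D.w p ∈ S → cycleT D.w p ∈ T)
    {f : D.BandModule c} (hf : D.SuppIn S f) : D.SuppIn T (D.arrowMap c α f) := by
  intro q hq
  rw [arrowMap_apply, Finset.sum_apply]
  refine Finset.sum_eq_zero fun p _ => ?_
  split_ifs with h1
  all_goals try rfl
  all_goals
    by_cases h2 : cycleS D.w p ∈ S
    · have h3 := h p (by rw [← h1]; rfl) h2
      have h4 : q ≠ cycleT D.w p := by rintro rfl; exact hq h3
      simp [Pi.single_eq_of_ne h4]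
    · simp [hf _ h2]

lemma prod_supp {c : k} {S : Set (Fin D.w.length)} (r : List D.quiv.A)
    (h : ∀ α ∈ r, ∀ p : Fin D.w.length, (D.w.get p).arrow = D.label α →
      cycleS D.w p ∈ S → cycleT D.w p ∈ S)
    {f : D.BandModule c} (hf : D.SuppIn S f) :
    D.SuppIn S ((r.map (D.arrowMap c)).prod f) := by
  induction r with
  | nil => simpa using hf
  | cons α r ih =>
    rw [List.map_cons, List.prod_cons, Module.End.mul_apply]
    exact D.arrowMap_supp (h α (by simp)) (ih fun β hβ => h β (by simp [hβ]))

lemma rel_zero (c : k) {r : List D.quiv.A} (hr : r ∈ D.rel) :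
    (r.map (D.arrowMap c)).prod = 0 := by
  obtain ⟨i, hi, h⟩ := hr
  have hj := D.isInverse_σ hi
  have hne := D.ne_σ hi
  have d1 : ((D.u i).getLast (D.u_ne i)).dir = true := by
    rw [dir_uLast]; exact hi _ (List.head_mem _)
  have d2 : ((D.u (D.σ i)).getLast (D.u_ne (D.σ i))).dir = false := by
    rw [dir_uLast]; exact hj _ (List.head_mem _)
  have d3 : ((D.u (cyc i)).head (D.u_ne (cyc i))).dir = false := by
    rw [dir_uFirst, hi _ (List.getLast_mem _)]; rfl
  have d4 : ((D.u (cyc (D.σ i))).head (D.u_ne (cyc (D.σ i)))).dir = true := by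
    rw [dir_uFirst, hj _ (List.getLast_mem _)]; rfl
  have univ : ∀ f : D.BandModule c, D.SuppIn Set.univ f := fun f p hp => absurd (Set.mem_univ p) hp
  have fin : ∀ f : D.BandModule c, D.SuppIn ∅ f → f = 0 := fun f hf => funext fun p => hf p (by simp)
  have last_kill : ∀ α, D.label α = D.uLast i → ∀ f : D.BandModule c,
      D.SuppIn (D.vSet (D.σ i)) f → D.arrowMap c α f = 0 := by
    intro α hα f hf
    refine fin _ (D.arrowMap_supp (fun p hp hs => ?_) hf)
    obtain ⟨e1, e2⟩ := D.pos_uLast (hp.trans hα)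
    rw [D.cycle_s_direct (by rw [e1, d1])] at hs
    exact absurd (D.vSet_disj e2 hs) hne
  have first_kill : ∀ α, D.label α = D.uFirst (cyc i) → ∀ f : D.BandModule c,
      D.SuppIn (D.vSet (D.σ i)) f → D.arrowMap c α f = 0 := by
    intro α hα f hf
    refine fin _ (D.arrowMap_supp (fun p hp hs => ?_) hf)
    obtain ⟨e1, e2⟩ := D.pos_uFirst (hp.trans hα)
    rw [D.cycle_s_inverse (by rw [e1, d3])] at hs
    exact absurd (D.vSet_disj e2 hs) hne
  have last_supp : ∀ α, D.label α = D.uLast (D.σ i) → ∀ f : D.BandModule c,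
      D.SuppIn (D.vSet (D.σ i)) (D.arrowMap c α f) := by
    intro α hα f
    refine D.arrowMap_supp (fun p hp _ => ?_) (univ f)
    obtain ⟨e1, e2⟩ := D.pos_uLast (hp.trans hα)
    rwa [D.cycle_t_inverse (by rw [e1, d2])]
  have first_supp : ∀ α, D.label α = D.uFirst (cyc (D.σ i)) → ∀ f : D.BandModule c,
      D.SuppIn (D.vSet (D.σ i)) (D.arrowMap c α f) := by
    intro α hα f
    refine D.arrowMap_supp (fun p hp _ => ?_) (univ f)
    obtain ⟨e1, e2⟩ := D.pos_uFirst (hp.trans hα)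
    rwa [D.cycle_t_direct (by rw [e1, d4])]
  refine LinearMap.ext fun f => ?_
  rcases h with h | h | h
  · obtain ⟨α, β, rfl⟩ : ∃ α β, r = [α, β] := by
      have := congrArg List.length h
      simp only [List.length_map, List.length_cons, List.length_nil] at this
      exact List.length_eq_two.1 this
    simp only [List.map_cons, List.map_nil, List.cons.injEq, and_true] at h
    simp only [List.map_cons, List.map_nil, List.prod_cons, List.prod_nil, mul_one,
      Module.End.mul_apply]
    exact last_kill α h.1 _ (first_supp β h.2 f)
  · obtain ⟨α, β, rfl⟩ : ∃ α β, r = [α, β] := by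
      have := congrArg List.length h
      simp only [List.length_map, List.length_cons, List.length_nil] at this
      exact List.length_eq_two.1 this
    simp only [List.map_cons, List.map_nil, List.cons.injEq, and_true] at h
    simp only [List.map_cons, List.map_nil, List.prod_cons, List.prod_nil, mul_one,
      Module.End.mul_apply]
    exact first_kill α h.1 _ (last_supp β h.2 f)
  · obtain ⟨α, r', rfl, hα, h⟩ := List.map_eq_cons_iff.1 h
    obtain ⟨r₁, r₂, rfl, h₁, h₂⟩ := List.map_eq_append_iff.1 h
    obtain ⟨β, r₃, rfl, hβ, h₃⟩ := List.map_eq_cons_iff.1 h₂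
    obtain rfl := List.map_eq_nil_iff.1 h₃
    simp only [List.map_cons, List.map_append, List.map_nil, List.prod_cons, List.prod_append,
      List.prod_nil, mul_one, Module.End.mul_apply]
    refine last_kill α hα _ (D.prod_supp r₁ ?_ (last_supp β hβ f))
    intro γ hγ p hp hs
    have hγ' : D.label γ ∈ (D.v i).map Letter.arrow := h₁ ▸ List.mem_map_of_mem hγ
    obtain ⟨l, hl, e⟩ := List.mem_map.1 hγ'
    rcases D.pos_v hl (hp.trans e.symm) with ⟨m1, m2⟩ | ⟨m1, m2⟩
    · exfalso
      have : cycleS D.w p ∈ D.vSet i := by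
        cases hd : (D.w.get p).dir
        · rwa [D.cycle_s_inverse hd]
        · rwa [D.cycle_s_direct hd]
      exact hne (D.vSet_disj this hs)
    · cases hd : (D.w.get p).dir
      · rwa [D.cycle_t_inverse hd]
      · rwa [D.cycle_t_direct hd]

/-- The action of the generators. -/
def genMap (c : k) : D.quiv.V ⊕ D.quiv.A → Module.End k (D.BandModule c) :=
  Sum.elim (D.vertexMap c) (D.arrowMap c)

lemma genMap_rel (c : k) ⦃a b : FreeAlgebra k (D.quiv.V ⊕ D.quiv.A)⦄
    (h : PathRel k D.quiv D.rel a b) :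
    FreeAlgebra.lift k (D.genMap c) a = FreeAlgebra.lift k (D.genMap c) b := by
  classical
  induction h with
  | idem x =>
    simp only [map_mul, FreeAlgebra.lift_ι_apply, genMap, Sum.elim_inl]
    refine LinearMap.ext fun f => funext fun q => ?_
    rw [Module.End.mul_apply, vertexMap_apply, vertexMap_apply]
    split_ifs <;> rfl
  | orth x y hxy =>
    simp only [map_mul, map_zero, FreeAlgebra.lift_ι_apply, genMap, Sum.elim_inl]
    refine LinearMap.ext fun f => funext fun q => ?_
    rw [Module.End.mul_apply, vertexMap_apply, vertexMap_apply]
    split_ifs with h1 h2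
    · exact absurd (h1.symm.trans h2) hxy
    · rfl
    · rfl
  | sum_one =>
    have := Fintype.ofFinite D.quiv.V
    rw [finsum_eq_sum_of_fintype, map_sum, map_one]
    simp only [FreeAlgebra.lift_ι_apply, genMap, Sum.elim_inl]
    refine LinearMap.ext fun f => funext fun q => ?_
    have e : (∑ x, D.vertexMap c x) f q = ∑ x, D.vertexMap c x f q := by
      rw [LinearMap.sum_apply]
      exact Finset.sum_apply q _ _
    rw [e]
    simp only [vertexMap_apply]
    rw [Finset.sum_eq_single (D.vtx q)]
    · simp
    · intro x _ hx
      exact if_neg hx.symm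
    · simp
  | tgt α =>
    simp only [map_mul, FreeAlgebra.lift_ι_apply, genMap, Sum.elim_inl, Sum.elim_inr]
    refine LinearMap.ext fun f => funext fun q => ?_
    rw [Module.End.mul_apply, vertexMap_apply]
    split_ifs with h
    · rfl
    · rw [arrowMap_apply, Finset.sum_apply]
      refine (Finset.sum_eq_zero fun p _ => ?_).symm
      by_cases h1 : D.arr p = α
      · have h4 : q ≠ cycleT D.w p := by
          rintro rfl
          apply h
          rw [← h1]
          rfl
        rw [if_pos h1, Pi.smul_apply, Pi.single_eq_of_ne h4, smul_zero]
      · rw [if_neg h1]; rfl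
  | src α =>
    simp only [map_mul, FreeAlgebra.lift_ι_apply, genMap, Sum.elim_inl, Sum.elim_inr]
    refine LinearMap.ext fun f => ?_
    rw [Module.End.mul_apply, arrowMap_apply, arrowMap_apply]
    refine Finset.sum_congr rfl fun p _ => ?_
    by_cases h1 : D.arr p = α
    · have h2 : D.vtx (cycleS D.w p) = D.quiv.s α := by rw [← h1]; rfl
      rw [if_pos h1, if_pos h1, vertexMap_apply, if_pos h2]
    · rw [if_neg h1, if_neg h1]
  | rel r hr =>
    rw [map_zero, map_list_prod, List.map_map, ← D.rel_zero c hr]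
    congr 2
    funext α
    simp [genMap]

/-- The structure map of the `W(w)`-module `M(w, λ)`. -/
def action (c : k) : D.algebra k →ₐ[k] Module.End k (D.BandModule c) :=
  RingQuot.liftAlgHom k ⟨FreeAlgebra.lift k (D.genMap c), D.genMap_rel c⟩

instance (c : k) : Module (D.algebra k) (D.BandModule c) :=
  Module.compHom _ (D.action c).toRingHom

instance (c : k) : IsScalarTower k (D.algebra k) (D.BandModule c) where
  smul_assoc a x m := by
    change D.action c (a • x) m = a • D.action c x m
    rw [map_smul, LinearMap.smul_apply]

instance (c : k) : SMulCommClass (D.algebra k) k (D.BandModule c) where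
  smul_comm x a m := (D.action c x).map_smul a m

/-- The endomorphism ring of the `W(w)`-module `M(w, λ)`. -/
abbrev EndBand (c : k) : Type _ := Module.End (D.algebra k) (D.BandModule c)

end

end WindWheel

end WindWheels

namespace WindWheels

namespace WindWheel

universe uV uA uk

variable {Q : Quiv.{uV, uA}} {ρ : Set (List Q.A)} (D : WindWheel Q ρ)

/-! ### Vertices and arrows of the wind wheel quiver -/

/-! Two basis vectors of `M` lie at the same vertex of `W` only if they are exchanged by `twin`,
which matches the bar `v_i` with the bar `v_{σ(i)}` in reversed order (`vtx_eq`). So an endomorphism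
`f` sends `e_p` to `a_p e_p + b_p e_{twin p}`, with the second term only on bars. Comparing
coefficients in `f(α e) = α f(e)` for each arrow `α` shows that `a_p` is constant around the cycle
(`coeff_self`) and that `b_p` is constant along each bar (`coeff_twin_vPos`).

The attracting conditions fix how a bar sits in the cycle quiver: no outside arrow ends in a direct
bar (`IsU.cycleT_notMem`) and none starts in an inverse bar (`IsU.cycleS_notMem`). A direct bar thus
gives a factor module of `M`, an inverse bar a submodule, and the two are isomorphic for `i` and
`σ(i)`. Hence each of the `t` direct bars contributes an endomorphism `M → bar → M` (`barEnd`). On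
an inverse bar `b_p` vanishes, since an outside arrow ends there (`coeff_twin_inverse`).

So `E` is `k · 1` plus a `t`-dimensional space `N` of maps from direct to inverse bars. Composites
of two such maps vanish (`mul_eq_zero_of_coeff`), so `N`, the kernel of the diagonal coefficient
`diag`, is the radical.

An endomorphism outside `N` is invertible, and the image of a nonzero one in `N` contains a whole
bar. Either way the image contains a vector that an arrow sends to a nonzero vector killed by all
arrows; this is impossible in a semisimple submodule (`basisVec_notMem_of_isSemisimple`). -/

lemma length_pos : 0 < D.w.length := List.length_pos_iff.2 D.cyclic.word.ne_nil

lemma t_pos : 0 < D.t := by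
  by_contra h
  have h0 : D.t = 0 := by omega
  have h1 := D.off_end
  rw [h0, mul_zero, off_zero] at h1
  exact absurd D.length_pos (by omega)

/-- The `r`-th vertex on the path `v_i`. -/
def vPos (i : Fin (2 * D.t)) (r : ℕ) : Fin D.w.length :=
  ⟨(D.off i + (D.u i).length + r) % D.w.length, Nat.mod_lt _ D.length_pos⟩

lemma mem_vSet {i : Fin (2 * D.t)} {p : Fin D.w.length} :
    p ∈ D.vSet i ↔ ∃ r ≤ (D.v i).length, p = D.vPos i r := by
  simp only [vSet, vPos, Set.mem_ofPred_eq, Fin.ext_iff]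

lemma vPos_mem {i : Fin (2 * D.t)} {r : ℕ} (hr : r ≤ (D.v i).length) : D.vPos i r ∈ D.vSet i :=
  D.mem_vSet.2 ⟨r, hr, rfl⟩

lemma vPos_val {i : Fin (2 * D.t)} {r : ℕ} (hr : r < (D.v i).length) :
    (D.vPos i r).val = D.off i + (D.u i).length + r := by
  have := D.off_le i
  exact Nat.mod_eq_of_lt (by omega)

lemma vPos_inj {i : Fin (2 * D.t)} {r r' : ℕ} (hr : r ≤ (D.v i).length)
    (hr' : r' ≤ (D.v i).length) (h : D.vPos i r = D.vPos i r') : r = r' := by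
  have h1 := D.off_le i
  have h2 := D.u_pos i
  have h3 := congrArg Fin.val h
  simp only [vPos] at h3
  -- As `u_i` is nonempty, the unreduced positions lie in `1, …, n`, where reduction modulo `n` is
  -- injective: only `n` itself wraps to `0`.
  have aux : ∀ n x : ℕ, 0 < x → x ≤ n → (x % n = x ∧ x < n) ∨ (x % n = 0 ∧ x = n) := by
    intro n x hx hn
    rcases hn.lt_or_eq with h | h
    · exact Or.inl ⟨Nat.mod_eq_of_lt h, h⟩
    · exact Or.inr ⟨by rw [h, Nat.mod_self], h⟩
  have b1 := aux D.w.length (D.off i + (D.u i).length + r) (by omega) (by omega)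
  have b2 := aux D.w.length (D.off i + (D.u i).length + r') (by omega) (by omega)
  omega

lemma cyc_vPos (i : Fin (2 * D.t)) (r : ℕ) : cyc (D.vPos i r) = D.vPos i (r + 1) := by
  simp only [cyc, vPos, Nat.mod_add_mod, add_assoc]

lemma get_vPos {i : Fin (2 * D.t)} {r : ℕ} (hr : r < (D.v i).length) :
    D.w.get (D.vPos i r) = (D.v i)[r] := by
  have h1 := D.w_get i ((D.u i).length + r) (by simp; omega)
  rw [List.getElem_append_right (by omega)] at h1
  have h2 := D.vPos_val hr
  rw [← add_assoc, ← h2, List.getElem?_eq_getElem (D.vPos i r).isLt] at h1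
  simpa using h1

lemma length_v_σ (i : Fin (2 * D.t)) : (D.v (D.σ i)).length = (D.v i).length := by
  rw [D.v_inv i]
  simp [invWord]

lemma get_v_σ {i : Fin (2 * D.t)} {r : ℕ} (hr : r < (D.v i).length) :
    (D.v (D.σ i))[(D.v i).length - 1 - r]'(by rw [length_v_σ]; omega) = (D.v i)[r].inv := by
  have h : ∀ r (hr : r < (D.v (D.σ i)).length), (D.v (D.σ i))[r] =
      ((D.v i)[(D.v i).length - 1 - r]'(by rw [length_v_σ] at hr; omega)).inv := by
    intro r hr
    have e : D.v (D.σ i) = invWord (D.v i) := by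
      conv_lhs => rw [D.v_inv (D.σ i), D.σ_invol i]
    have hr' : r < (invWord (D.v i)).length := by rwa [← e]
    have : (D.v (D.σ i))[r] = (invWord (D.v i))[r] := by simp only [e]
    rw [this]
    simp [invWord]
  rw [h]
  congr 2
  omega

lemma exists_position (p : Fin D.w.length) :
    (∃ i, ∃ r < (D.u i).length, p.val = D.off i + r) ∨
      ∃ i, ∃ r < (D.v i).length, p = D.vPos i r := by
  have key : ∀ m ≤ 2 * D.t, p.val < D.off m → ∃ i : Fin (2 * D.t),
      D.off i ≤ p.val ∧ p.val < D.off (i.val + 1) := by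
    intro m
    induction m with
    | zero => intro _ h; rw [off_zero] at h; omega
    | succ m ih =>
      intro hm h
      by_cases h1 : p.val < D.off m
      · exact ih (by omega) h1
      · exact ⟨⟨m, hm⟩, not_lt.1 h1, h⟩
  obtain ⟨i, h1, h2⟩ := key (2 * D.t) le_rfl (by rw [off_end]; exact p.isLt)
  rw [off_succ] at h2
  by_cases h3 : p.val < D.off i + (D.u i).length
  · exact Or.inl ⟨i, p.val - D.off i, by omega, by omega⟩
  · have hr : p.val - (D.off i + (D.u i).length) < (D.v i).length := by omega
    refine Or.inr ⟨i, _, hr, Fin.ext ?_⟩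
    rw [D.vPos_val hr]
    omega

/-- The letter of `w` at the position `p` belongs to some `u_i`. -/
def IsU (p : Fin D.w.length) : Prop := ∃ i, D.w.get p ∈ D.u i

lemma isU_or_vPos (p : Fin D.w.length) :
    D.IsU p ∨ ∃ i, ∃ r < (D.v i).length, p = D.vPos i r := by
  rcases D.exists_position p with ⟨i, r, hr, h⟩ | h
  · left
    have h1 := D.w_get i r (by simp; omega)
    rw [← h, List.getElem?_eq_getElem p.isLt, List.getElem_append_left hr] at h1
    refine ⟨i, ?_⟩
    have h2 : D.w.get p = (D.u i)[r] := by simpa using h1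
    rw [h2]
    exact List.getElem_mem _
  · exact Or.inr h

/-- Inversion of letters is an involution and the letters of `w` are distinct, so the generated
equivalence relation has classes of at most two elements. -/
lemma arr_eq {p q : Fin D.w.length} (h : D.arr p = D.arr q) :
    p = q ∨ D.w.get p = (D.w.get q).inv := by
  have h1 := Quot.eqvGen_exact h
  have inv_inv : ∀ l : Letter Q, l.inv.inv = l := fun l => by simp [Letter.inv]
  have inj := List.nodup_iff_injective_get.1 D.nodup
  clear h
  induction h1 with
  | rel x y h => exact Or.inr h
  | refl x => exact Or.inl rfl
  | symm x y _ ih =>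
    rcases ih with h | h
    · exact Or.inl h.symm
    · exact Or.inr (by rw [h, inv_inv])
  | trans x y z _ _ h1 h2 =>
    rcases h1 with rfl | h1
    · exact h2
    · rcases h2 with rfl | h2
      · exact Or.inr h1
      · exact Or.inl (inj (by rw [h1, h2, inv_inv]))

lemma IsU.eq_of_arr_eq {D : WindWheel Q ρ} {p q : Fin D.w.length} (hp : D.IsU p)
    (h : D.arr q = D.arr p) : q = p := by
  obtain ⟨i, hi⟩ := hp
  exact D.pos_u hi (congrArg D.label h) rfl

/-- The position of the letter of `v_{σ(i)}` corresponding to the letter of `v_i` at `vPos i r`. -/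
def vTwin (i : Fin (2 * D.t)) (r : ℕ) : Fin D.w.length :=
  D.vPos (D.σ i) ((D.v i).length - 1 - r)

lemma get_vTwin {i : Fin (2 * D.t)} {r : ℕ} (hr : r < (D.v i).length) :
    D.w.get (D.vTwin i r) = (D.w.get (D.vPos i r)).inv := by
  rw [vTwin, D.get_vPos (by rw [length_v_σ]; omega), D.get_v_σ hr, D.get_vPos hr]

lemma arr_vPos {i : Fin (2 * D.t)} {r : ℕ} (hr : r < (D.v i).length) {x : Fin D.w.length} :
    D.arr x = D.arr (D.vPos i r) ↔ x = D.vPos i r ∨ x = D.vTwin i r := by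
  constructor
  · intro h
    rcases D.arr_eq h with h | h
    · exact Or.inl h
    · right
      rw [← D.get_vTwin hr] at h
      exact List.nodup_iff_injective_get.1 D.nodup h
  · rintro (rfl | rfl)
    · rfl
    · exact Quot.sound (D.get_vTwin hr)

/-! ### The involution on the vertices of the cycle -/

lemma σ_ne (i : Fin (2 * D.t)) : D.σ i ≠ i := by
  rcases D.v_serial i with h | h
  · exact (D.ne_σ h).symm
  · intro e
    have h1 := h _ (List.head_mem (D.v_ne i))
    have h2 := h _ (e ▸ D.inv_mem (List.head_mem (D.v_ne i)))
    simp [Letter.inv, h1] at h2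

open Classical in
/-- The involution exchanging the vertices of the cycle quiver that are identified in the wind
wheel quiver. -/
noncomputable def twin (p : Fin D.w.length) : Fin D.w.length :=
  if h : ∃ ir : Fin (2 * D.t) × ℕ, ir.2 ≤ (D.v ir.1).length ∧ p = D.vPos ir.1 ir.2 then
    D.vPos (D.σ h.choose.1) ((D.v h.choose.1).length - h.choose.2) else p

/-- Bars are disjoint and their vertices distinct, so the choice in `twin` is forced. A bar has one
more vertex than letters: vertices are reversed by `length - r`, letters by `length - 1 - r`. -/
lemma twin_vPos {i : Fin (2 * D.t)} {r : ℕ} (hr : r ≤ (D.v i).length) :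
    D.twin (D.vPos i r) = D.vPos (D.σ i) ((D.v i).length - r) := by
  have h : ∃ ir : Fin (2 * D.t) × ℕ, ir.2 ≤ (D.v ir.1).length ∧
      D.vPos i r = D.vPos ir.1 ir.2 := ⟨(i, r), hr, rfl⟩
  rw [twin, dif_pos h]
  obtain ⟨h1, h2⟩ := h.choose_spec
  have h3 : i = h.choose.1 := D.vSet_disj (D.vPos_mem hr) (by
    have h3 := D.vPos_mem h1
    rwa [← h2] at h3)
  rw [← h3] at h1 h2 ⊢
  rw [← D.vPos_inj hr h1 h2]

lemma twin_of_notMem {p : Fin D.w.length} (h : ∀ i, p ∉ D.vSet i) : D.twin p = p := by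
  rw [twin, dif_neg]
  rintro ⟨ir, h1, rfl⟩
  exact h _ (D.vPos_mem h1)

lemma twin_mem {i : Fin (2 * D.t)} {p : Fin D.w.length} (h : p ∈ D.vSet i) :
    D.twin p ∈ D.vSet (D.σ i) := by
  obtain ⟨r, hr, rfl⟩ := D.mem_vSet.1 h
  rw [D.twin_vPos hr]
  exact D.vPos_mem (by rw [length_v_σ]; omega)

lemma twin_ne {i : Fin (2 * D.t)} {p : Fin D.w.length} (h : p ∈ D.vSet i) : D.twin p ≠ p :=
  fun e => D.σ_ne i (D.vSet_disj (D.twin_mem h) (e.symm ▸ h))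

lemma twin_twin (p : Fin D.w.length) : D.twin (D.twin p) = p := by
  by_cases h : ∃ i, p ∈ D.vSet i
  · obtain ⟨i, h⟩ := h
    obtain ⟨r, hr, rfl⟩ := D.mem_vSet.1 h
    rw [D.twin_vPos hr, D.twin_vPos (by rw [length_v_σ]; omega), D.σ_invol, length_v_σ]
    congr 1
    omega
  · have h' : D.twin p = p := D.twin_of_notMem fun i hi => h ⟨i, hi⟩
    rw [h', h']

lemma cyc_vTwin {i : Fin (2 * D.t)} {r : ℕ} (hr : r < (D.v i).length) :
    cyc (D.vTwin i r) = D.twin (D.vPos i r) := by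
  rw [vTwin, cyc_vPos, D.twin_vPos hr.le]
  congr 1
  omega

lemma vTwin_eq {i : Fin (2 * D.t)} {r : ℕ} (hr : r < (D.v i).length) :
    D.vTwin i r = D.twin (cyc (D.vPos i r)) := by
  rw [vTwin, cyc_vPos, D.twin_vPos hr]
  congr 1
  omega

lemma dir_vTwin {i : Fin (2 * D.t)} {r : ℕ} (hr : r < (D.v i).length) :
    (D.w.get (D.vTwin i r)).dir = !(D.w.get (D.vPos i r)).dir := by
  rw [D.get_vTwin hr]
  rfl

/-- Passing to the twin letter reverses both the order of the two endpoints in `w` and the direction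
of the letter; the two reversals cancel, so starting points correspond. -/
lemma cycleS_vTwin {i : Fin (2 * D.t)} {r : ℕ} (hr : r < (D.v i).length) :
    cycleS D.w (D.vTwin i r) = D.twin (cycleS D.w (D.vPos i r)) := by
  have h := D.dir_vTwin hr
  cases h1 : (D.w.get (D.vPos i r)).dir <;> rw [h1] at h
  · rw [D.cycle_s_direct h, D.cycle_s_inverse h1, D.cyc_vTwin hr]
  · rw [D.cycle_s_inverse h, D.cycle_s_direct h1, D.vTwin_eq hr]

lemma cycleT_vTwin {i : Fin (2 * D.t)} {r : ℕ} (hr : r < (D.v i).length) :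
    cycleT D.w (D.vTwin i r) = D.twin (cycleT D.w (D.vPos i r)) := by
  have h := D.dir_vTwin hr
  cases h1 : (D.w.get (D.vPos i r)).dir <;> rw [h1] at h
  · rw [D.cycle_t_direct h, D.cycle_t_inverse h1, D.vTwin_eq hr]
  · rw [D.cycle_t_inverse h, D.cycle_t_direct h1, D.cyc_vTwin hr]

/-- The first letter of `w` belongs to a `u`, so the parameter `c` never enters the action of a bar
arrow. -/
lemma vPos_ne_zero {i : Fin (2 * D.t)} {r : ℕ} (hr : r < (D.v i).length) :
    (D.vPos i r).val ≠ 0 := by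
  rw [D.vPos_val hr]
  have := D.u_pos i
  omega

lemma vTwin_ne_zero {i : Fin (2 * D.t)} {r : ℕ} (hr : r < (D.v i).length) :
    (D.vTwin i r).val ≠ 0 :=
  D.vPos_ne_zero (by rw [length_v_σ]; omega)

lemma vPos_ne_vTwin {i : Fin (2 * D.t)} {r : ℕ} (hr : r < (D.v i).length) :
    D.vPos i r ≠ D.vTwin i r := by
  intro h
  have h1 := D.dir_vTwin hr
  rw [← h] at h1
  simp at h1

lemma cycleS_mem {i : Fin (2 * D.t)} {r : ℕ} (hr : r < (D.v i).length) :
    cycleS D.w (D.vPos i r) ∈ D.vSet i := by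
  cases h1 : (D.w.get (D.vPos i r)).dir
  · rw [D.cycle_s_inverse h1]; exact D.vPos_mem hr.le
  · rw [D.cycle_s_direct h1, cyc_vPos]; exact D.vPos_mem hr

lemma cycleT_mem {i : Fin (2 * D.t)} {r : ℕ} (hr : r < (D.v i).length) :
    cycleT D.w (D.vPos i r) ∈ D.vSet i := by
  cases h1 : (D.w.get (D.vPos i r)).dir
  · rw [D.cycle_t_inverse h1, cyc_vPos]; exact D.vPos_mem hr
  · rw [D.cycle_t_direct h1]; exact D.vPos_mem hr.le

/-- A letter of `w` with inverse letter also in `w` belongs to some `v_i`. -/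
lemma exists_vPos_of_inv {p q : Fin D.w.length} (h : D.w.get p = (D.w.get q).inv) :
    ∃ i, ∃ r < (D.v i).length, p = D.vPos i r ∧ q = D.vTwin i r := by
  have h2 : D.arr q = D.arr p := (Quot.sound h : D.arr p = D.arr q).symm
  have hne : q ≠ p := by
    rintro rfl
    have := congrArg Letter.dir h
    simp [Letter.inv] at this
  rcases D.isU_or_vPos p with hp | ⟨i, r, hr, rfl⟩
  · exact absurd (hp.eq_of_arr_eq h2) hne
  · exact ⟨i, r, hr, rfl, ((D.arr_vPos hr).1 h2).resolve_left hne⟩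

lemma vtx_eq {p q : Fin D.w.length} : D.vtx p = D.vtx q ↔ q = p ∨ q = D.twin p := by
  constructor
  · intro h
    have h1 := Quot.eqvGen_exact h
    clear h
    induction h1 with
    | rel x y h =>
      obtain ⟨p, q, h, rfl, rfl⟩ := h
      obtain ⟨i, r, hr, rfl, rfl⟩ := D.exists_vPos_of_inv h
      exact Or.inr (D.cyc_vTwin hr)
    | refl x => exact Or.inl rfl
    | symm x y _ ih =>
      rcases ih with rfl | rfl
      · exact Or.inl rfl
      · exact Or.inr (D.twin_twin _).symm
    | trans x y z _ _ h1 h2 =>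
      rcases h1 with rfl | rfl
      · exact h2
      · rw [twin_twin] at h2
        exact h2.symm
  · rintro (rfl | rfl)
    · rfl
    · by_cases h : ∃ i, p ∈ D.vSet i
      · obtain ⟨i, h⟩ := h
        obtain ⟨r, hr, rfl⟩ := D.mem_vSet.1 h
        -- All vertices of the bar but the last are matched by the bar letter that follows them, the
        -- last one by the letter that precedes it.
        rcases hr.lt_or_eq with hr | rfl
        · exact Quot.sound ⟨_, D.vTwin i r, by rw [D.get_vTwin hr]; simp [Letter.inv], rfl,
            (D.cyc_vTwin hr).symm⟩
        · have h0 := D.v_pos i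
          have h1 : (D.v i).length - 1 < (D.v i).length := by omega
          have h2 : D.vPos i (D.v i).length = cyc (D.vPos i ((D.v i).length - 1)) := by
            rw [cyc_vPos]; congr 1; omega
          rw [h2, ← D.vTwin_eq h1]
          exact (Quot.sound ⟨_, _, D.get_vTwin h1, rfl, rfl⟩ : D.vtx _ = D.vtx _).symm
      · rw [D.twin_of_notMem fun i hi => h ⟨i, hi⟩]

/-! ### Direct and inverse bars -/

/-- The letter before `v_i` belongs to some `u_j`, and has the direction of `v_i`. -/
lemma cyc_eq_vPos_zero {i : Fin (2 * D.t)} {p : Fin D.w.length}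
    (h : cyc p = D.vPos i 0) : (D.w.get p).dir = ((D.v i).head (D.v_ne i)).dir ∧ D.IsU p := by
  have h0 := D.u_pos i
  have h1 := D.w_get i ((D.u i).length - 1) (by simp; omega)
  have h2 := D.off_le i
  have h3 : D.off i + ((D.u i).length - 1) < D.w.length := by have := D.v_pos i; omega
  have h4 : D.w.get ⟨D.off i + ((D.u i).length - 1), h3⟩ = (D.u i).getLast (D.u_ne i) := by
    rw [List.getElem?_eq_getElem h3, List.getElem_append_left (by omega)] at h1
    rw [List.getLast_eq_getElem]
    simpa using h1
  have h5 : p = ⟨D.off i + ((D.u i).length - 1), h3⟩ := by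
    have h6 := congrArg Fin.val h
    rw [D.vPos_val (D.v_pos i)] at h6
    simp only [cyc] at h6
    have h7 := p.isLt
    rcases (Nat.succ_le_of_lt h7).lt_or_eq with h8 | h8
    · rw [Nat.mod_eq_of_lt h8] at h6
      exact Fin.ext (by simp only; omega)
    · rw [← Nat.succ_eq_add_one, h8, Nat.mod_self] at h6
      omega
  subst h5
  refine ⟨by rw [h4, dir_uLast], i, ?_⟩
  rw [h4]
  exact List.getLast_mem _

/-- The letter after `v_i` belongs to some `u_j`, and has the direction opposite to `v_i`. -/
lemma dir_vPos_last {i : Fin (2 * D.t)} :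
    (D.w.get (D.vPos i (D.v i).length)).dir = !((D.v i).getLast (D.v_ne i)).dir ∧
      D.IsU (D.vPos i (D.v i).length) := by
  have h0 := D.u_pos (cyc i)
  have h1 := D.w_get (cyc i) 0 (by simp; omega)
  have h2 := D.off_le (cyc i)
  have h3 : D.off (cyc i) + 0 < D.w.length := by omega
  have h4 : D.w.get ⟨D.off (cyc i) + 0, h3⟩ = (D.u (cyc i)).head (D.u_ne (cyc i)) := by
    rw [List.getElem?_eq_getElem h3, List.getElem_append_left (by omega)] at h1
    rw [List.head_eq_getElem]
    simpa using h1
  have h5 : D.vPos i (D.v i).length = ⟨D.off (cyc i) + 0, h3⟩ := by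
    refine Fin.ext ?_
    simp only [vPos]
    rw [← off_succ]
    -- The last bar ends at `n`, which is the position `0` where the first `u` begins.
    by_cases hi : i.val + 1 < 2 * D.t
    · have : (cyc i).val = i.val + 1 := Nat.mod_eq_of_lt hi
      rw [this] at h3 ⊢
      rw [Nat.mod_eq_of_lt (by omega)]
      omega
    · have hi' : i.val + 1 = 2 * D.t := by have := i.isLt; omega
      have : (cyc i).val = 0 := by simp [cyc, hi']
      simp [this, hi', off_zero, off_end]
  rw [h5, h4, dir_uFirst]
  refine ⟨rfl, cyc i, ?_⟩
  rw [h4]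
  exact List.head_mem _

lemma not_isU_vPos {i : Fin (2 * D.t)} {r : ℕ} (hr : r < (D.v i).length) :
    ¬ D.IsU (D.vPos i r) := fun h =>
  D.vPos_ne_vTwin hr (h.eq_of_arr_eq ((D.arr_vPos hr).2 (Or.inr rfl))).symm

lemma cyc_injective {n : ℕ} : Function.Injective (cyc (n := n)) := by
  intro p q h
  have h1 := congrArg Fin.val h
  simp only [cyc] at h1
  have hp := p.isLt
  have hq := q.isLt
  have aux : ∀ x, x < n → ((x + 1) % n = x + 1 ∧ x + 1 < n) ∨ ((x + 1) % n = 0 ∧ x + 1 = n) := by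
    intro x hx
    rcases (Nat.succ_le_of_lt hx).lt_or_eq with h | h
    · exact Or.inl ⟨Nat.mod_eq_of_lt h, h⟩
    · exact Or.inr ⟨by rw [← h]; exact Nat.mod_self _, h⟩
  have b1 := aux p hp
  have b2 := aux q hq
  exact Fin.ext (by omega)

/-- Every vertex of a bar except its first is preceded by a letter of the bar. -/
lemma IsU.eq_zero_of_cyc {D : WindWheel Q ρ} {i : Fin (2 * D.t)} {p : Fin D.w.length} {r : ℕ}
    (hp : D.IsU p) (hr : r ≤ (D.v i).length) (h : cyc p = D.vPos i r) : r = 0 := by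
  rcases Nat.eq_zero_or_pos r with h0 | h0
  · exact h0
  · obtain ⟨r, rfl⟩ : ∃ s, r = s + 1 := ⟨r - 1, by omega⟩
    rw [← cyc_vPos] at h
    exact absurd (cyc_injective h ▸ hp) (D.not_isU_vPos hr)

lemma IsU.dir_of_mem {D : WindWheel Q ρ} {i : Fin (2 * D.t)} {p : Fin D.w.length}
    (hp : D.IsU p) (h : p ∈ D.vSet i) :
    (D.w.get p).dir = !((D.v i).getLast (D.v_ne i)).dir := by
  obtain ⟨r, hr, rfl⟩ := D.mem_vSet.1 h
  rcases hr.lt_or_eq with hr | rfl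
  · exact absurd hp (D.not_isU_vPos hr)
  · exact D.dir_vPos_last.1

lemma IsU.dir_of_cyc_mem {D : WindWheel Q ρ} {i : Fin (2 * D.t)} {p : Fin D.w.length}
    (hp : D.IsU p) (h : cyc p ∈ D.vSet i) :
    (D.w.get p).dir = ((D.v i).head (D.v_ne i)).dir := by
  obtain ⟨r, hr, h⟩ := D.mem_vSet.1 h
  obtain rfl := hp.eq_zero_of_cyc hr h
  exact (D.cyc_eq_vPos_zero h).1

/-- No arrow outside of a direct bar ends in it. -/
lemma IsU.cycleT_notMem {D : WindWheel Q ρ} {i : Fin (2 * D.t)} {p : Fin D.w.length}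
    (hp : D.IsU p) (hi : IsDirect (D.v i)) : cycleT D.w p ∉ D.vSet i := by
  intro h
  cases hd : (D.w.get p).dir
  · rw [D.cycle_t_inverse hd] at h
    have := hp.dir_of_cyc_mem h
    rw [hd, hi _ (List.head_mem _)] at this
    exact absurd this (by decide)
  · rw [D.cycle_t_direct hd] at h
    have := hp.dir_of_mem h
    rw [hd, hi _ (List.getLast_mem _)] at this
    exact absurd this (by decide)

/-- No arrow outside of an inverse bar starts in it. -/
lemma IsU.cycleS_notMem {D : WindWheel Q ρ} {i : Fin (2 * D.t)} {p : Fin D.w.length}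
    (hp : D.IsU p) (hi : IsInverse (D.v i)) : cycleS D.w p ∉ D.vSet i := by
  intro h
  cases hd : (D.w.get p).dir
  · rw [D.cycle_s_inverse hd] at h
    have := hp.dir_of_mem h
    rw [hd, hi _ (List.getLast_mem _)] at this
    exact absurd this (by decide)
  · rw [D.cycle_s_direct hd] at h
    have := hp.dir_of_cyc_mem h
    rw [hd, hi _ (List.head_mem _)] at this
    exact absurd this (by decide)

/-- The arrows of an inverse bar run towards its last vertex and no outside arrow leaves the bar, so
this vertex is a sink of the cycle quiver; its basis vector will span a simple submodule. -/
lemma cycleS_ne_vPos_last {i : Fin (2 * D.t)} (hi : IsInverse (D.v i)) (p : Fin D.w.length) :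
    cycleS D.w p ≠ D.vPos i (D.v i).length := by
  intro h
  have hm : cycleS D.w p ∈ D.vSet i := h ▸ D.vPos_mem le_rfl
  rcases D.isU_or_vPos p with hp | ⟨j, r, hr, rfl⟩
  · exact hp.cycleS_notMem hi hm
  · obtain rfl := D.vSet_disj (D.cycleS_mem hr) hm
    have hd : (D.w.get (D.vPos j r)).dir = false := by
      rw [D.get_vPos hr]
      exact hi _ (List.getElem_mem _)
    rw [D.cycle_s_inverse hd] at h
    exact hr.ne (D.vPos_inj hr.le le_rfl h)

/-- The first vertex of an inverse bar is the terminal point of an arrow outside of the bars. -/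
lemma exists_cycleT_eq_vPos_zero {i : Fin (2 * D.t)} (hi : IsInverse (D.v i)) :
    ∃ p, D.IsU p ∧ cycleT D.w p = D.vPos i 0 := by
  obtain ⟨p, hp⟩ := Finite.surjective_of_injective (cyc_injective (n := D.w.length)) (D.vPos i 0)
  obtain ⟨h1, h2⟩ := D.cyc_eq_vPos_zero hp
  rw [hi _ (List.head_mem _)] at h1
  exact ⟨p, h2, by rw [D.cycle_t_inverse h1, hp]⟩

/-! ### Half of the bars are direct -/

lemma isDirect_σ {i : Fin (2 * D.t)} (h : IsInverse (D.v i)) : IsDirect (D.v (D.σ i)) := by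
  intro l hl
  have h1 := h _ (D.σ_invol i ▸ D.inv_mem hl)
  simpa [Letter.inv] using h1

lemma not_isDirect {i : Fin (2 * D.t)} (h : IsInverse (D.v i)) : ¬ IsDirect (D.v i) := by
  intro h'
  have h1 := h _ (List.head_mem (D.v_ne i))
  rw [h' _ (List.head_mem (D.v_ne i))] at h1
  cases h1

lemma card_isDirect : Nat.card {i : Fin (2 * D.t) // IsDirect (D.v i)} = D.t := by
  classical
  have e : {i : Fin (2 * D.t) // IsDirect (D.v i)} ≃ {i : Fin (2 * D.t) // ¬ IsDirect (D.v i)} :=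
    { toFun := fun i => ⟨D.σ i, D.not_isDirect (D.isInverse_σ i.2)⟩
      invFun := fun i => ⟨D.σ i, D.isDirect_σ ((D.v_serial i).resolve_left i.2)⟩
      left_inv := fun i => Subtype.ext (D.σ_invol i)
      right_inv := fun i => Subtype.ext (D.σ_invol i) }
  have h1 := Nat.card_congr e
  have h2 := Nat.card_congr (Equiv.sumCompl fun i : Fin (2 * D.t) => IsDirect (D.v i))
  rw [Nat.card_sum, Nat.card_eq_fintype_card (α := Fin _), Fintype.card_fin] at h2
  omega

/-! ### Linear maps commuting with the generators -/

noncomputable section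

variable {k : Type uk} [Field k] {c : k}

/-- The image of a generator in the wind wheel algebra. -/
def gen (x : D.quiv.V ⊕ D.quiv.A) : D.algebra k :=
  RingQuot.mkAlgHom k (PathRel k D.quiv D.rel) (FreeAlgebra.ι k x)

lemma action_gen (x : D.quiv.V ⊕ D.quiv.A) : D.action c (D.gen x) = D.genMap c x := by
  rw [gen, action, RingQuot.liftAlgHom_mkAlgHom_apply, FreeAlgebra.lift_ι_apply]

lemma algebra_smul_def (a : D.algebra k) (g : D.BandModule c) : a • g = D.action c a g := rfl

lemma gen_smul (x : D.quiv.V ⊕ D.quiv.A) (g : D.BandModule c) :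
    (D.gen x : D.algebra k) • g = D.genMap c x g := by
  rw [algebra_smul_def, action_gen]

lemma action_induction {P : Module.End k (D.BandModule c) → Prop}
    (scalar : ∀ a : k, P (algebraMap k _ a)) (gen : ∀ x, P (D.genMap c x))
    (mul : ∀ φ ψ, P φ → P ψ → P (φ * ψ)) (add : ∀ φ ψ, P φ → P ψ → P (φ + ψ))
    (a : D.algebra k) : P (D.action c a) := by
  obtain ⟨x, rfl⟩ := RingQuot.mkAlgHom_surjective k (PathRel k D.quiv D.rel) a
  induction x using FreeAlgebra.induction with
  | grade0 r => rw [AlgHom.commutes, AlgHom.commutes]; exact scalar r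
  | grade1 x =>
    have := gen x
    rw [← action_gen] at this
    exact this
  | mul a b ha hb => rw [map_mul, map_mul]; exact mul _ _ ha hb
  | add a b ha hb => rw [map_add, map_add]; exact add _ _ ha hb

/-- A linear map commuting with the generators of the wind wheel algebra is an endomorphism of the
band module. -/
def endOfCommute (φ : Module.End k (D.BandModule c))
    (h : ∀ x, φ * D.genMap c x = D.genMap c x * φ) : D.EndBand c where
  toFun := φ
  map_add' := φ.map_add
  map_smul' a g := by
    have : φ * D.action c a = D.action c a * φ := by
      refine D.action_induction (P := fun ψ => φ * ψ = ψ * φ) ?_ h ?_ ?_ a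
      · exact fun a => (Algebra.commutes a φ).symm
      · intro ψ ψ' h1 h2
        rw [← mul_assoc, h1, mul_assoc, h2, mul_assoc]
      · intro ψ ψ' h1 h2
        rw [mul_add, h1, h2, add_mul]
    exact LinearMap.congr_fun this g

/-- The basis vector `e_p`. -/
def basisVec (c : k) (p : Fin D.w.length) : D.BandModule c :=
  (Pi.single p 1 : Fin D.w.length → k)

lemma basisVec_apply (p q : Fin D.w.length) :
    D.basisVec c p q = if q = p then 1 else 0 := Pi.single_apply p 1 q

lemma single_eq_smul (p : Fin D.w.length) (a : k) :
    (Pi.single p a : Fin D.w.length → k) = (a • D.basisVec c p : D.BandModule c) := by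
  change _ = a • (Pi.single p 1 : Fin D.w.length → k)
  rw [← Pi.single_smul, smul_eq_mul, mul_one]

lemma sum_basisVec (g : D.BandModule c) : g = ∑ p, g p • D.basisVec c p := by
  simp_rw [← single_eq_smul]
  exact (Finset.univ_sum_single (g : Fin D.w.length → k)).symm

/-! ### The action of the arrows -/

lemma arrowMap_isU {p : Fin D.w.length} (hp : D.IsU p) (g : D.BandModule c) :
    D.arrowMap c (D.arr p) g =
      ((if p.val = 0 then c else 1) * g (cycleS D.w p)) • D.basisVec c (cycleT D.w p) := by
  classical
  rw [arrowMap_apply, Finset.sum_eq_single p, if_pos rfl, mul_smul, ← single_eq_smul]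
  · rfl
  · intro q _ hq
    exact if_neg fun h => hq (hp.eq_of_arr_eq h)
  · simp

/-- A bar arrow occurs at exactly two positions, the letter and its twin, both with factor `1`. -/
lemma arrowMap_vPos {i : Fin (2 * D.t)} {r : ℕ} (hr : r < (D.v i).length)
    (g : D.BandModule c) :
    D.arrowMap c (D.arr (D.vPos i r)) g =
      g (cycleS D.w (D.vPos i r)) • D.basisVec c (cycleT D.w (D.vPos i r)) +
      g (D.twin (cycleS D.w (D.vPos i r))) •
        D.basisVec c (D.twin (cycleT D.w (D.vPos i r))) := by
  classical
  rw [arrowMap_apply, Finset.sum_eq_add (D.vPos i r) (D.vTwin i r) (D.vPos_ne_vTwin hr),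
    if_pos rfl, if_pos ((D.arr_vPos hr).2 (Or.inr rfl)), if_neg (D.vPos_ne_zero hr),
    if_neg (D.vTwin_ne_zero hr), one_smul, one_smul, D.cycleS_vTwin hr, D.cycleT_vTwin hr,
    single_eq_smul, single_eq_smul]
  · rfl
  · rintro q - ⟨h1, h2⟩
    refine if_neg fun h => ?_
    rcases (D.arr_vPos hr).1 h with h | h
    · exact h1 h
    · exact h2 h
  · simp
  · simp

/-! ### The coefficients of an endomorphism -/

variable {D}

lemma end_smul (f : D.EndBand c) (a : k) (g : D.BandModule c) : f (a • g) = a • f g :=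
  f.map_smul_of_tower a g

lemma end_vertexMap (f : D.EndBand c) (x : D.quiv.V) (g : D.BandModule c) :
    f (D.vertexMap c x g) = D.vertexMap c x (f g) := by
  have h := f.map_smul (D.gen (Sum.inl x)) g
  rwa [gen_smul, gen_smul] at h

lemma end_arrowMap (f : D.EndBand c) (α : D.quiv.A) (g : D.BandModule c) :
    f (D.arrowMap c α g) = D.arrowMap c α (f g) := by
  have h := f.map_smul (D.gen (Sum.inr α)) g
  rwa [gen_smul, gen_smul] at h

/-- The coefficient of `f(e_p)` at `e_q`. -/
def coeff (p q : Fin D.w.length) : D.EndBand c →ₗ[k] k where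
  toFun f := f (D.basisVec c p) q
  map_add' _ _ := rfl
  map_smul' _ _ := rfl

lemma coeff_apply (p q : Fin D.w.length) (f : D.EndBand c) :
    coeff p q f = f (D.basisVec c p) q := rfl

lemma band_add_apply (g h : D.BandModule c) (q : Fin D.w.length) : (g + h) q = g q + h q := rfl

lemma band_smul_apply (a : k) (g : D.BandModule c) (q : Fin D.w.length) :
    (a • g) q = a * g q := rfl

lemma end_apply (f : D.EndBand c) (g : D.BandModule c) (q : Fin D.w.length) :
    f g q = ∑ p, g p * coeff p q f := by
  conv_lhs => rw [D.sum_basisVec g, map_sum]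
  refine (Finset.sum_apply q Finset.univ
    (fun p => (f (g p • D.basisVec c p) : Fin D.w.length → k))).trans ?_
  refine Finset.sum_congr rfl fun p _ => ?_
  rw [end_smul]
  rfl

/-- Compatibility with the idempotent at the vertex of `q`: it kills `e_p` when `p` lies at another
vertex of `W`. -/
lemma coeff_eq_zero (f : D.EndBand c) {p q : Fin D.w.length} (h1 : q ≠ p)
    (h2 : q ≠ D.twin p) : coeff p q f = 0 := by
  classical
  have h := congrFun (end_vertexMap f (D.vtx q) (D.basisVec c p)) q
  have hv : D.vertexMap c (D.vtx q) (D.basisVec c p) = 0 := by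
    funext x
    rw [vertexMap_apply, basisVec_apply]
    split_ifs with h3 h4
    · subst h4
      rcases D.vtx_eq.1 h3 with h5 | h5
      · exact absurd h5 h1
      · exact absurd h5 h2
    · rfl
    · rfl
  rw [hv, map_zero, vertexMap_apply, if_pos rfl] at h
  exact h.symm

/-- An arrow outside the bars has rank one: it reads only the coefficient at its starting point and
has image the line of `e` at its end. Its factor may be `c`, which has to be cancelled. -/
lemma coeff_isU (hc : c ≠ 0) (f : D.EndBand c) {p : Fin D.w.length} (hp : D.IsU p)
    (y : Fin D.w.length) : coeff (cycleT D.w p) y f =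
      if y = cycleT D.w p then coeff (cycleS D.w p) (cycleS D.w p) f else 0 := by
  have h := congrFun (end_arrowMap f (D.arr p) (D.basisVec c (cycleS D.w p))) y
  rw [arrowMap_isU D hp, arrowMap_isU D hp, end_smul, basisVec_apply, if_pos rfl, mul_one] at h
  rw [band_smul_apply, band_smul_apply, basisVec_apply, mul_assoc] at h
  have h0 : (if p.val = 0 then c else 1) ≠ 0 := by split_ifs <;> simp [hc]
  have h1 := mul_left_cancel₀ h0 h
  rw [coeff_apply, h1, coeff_apply]
  split_ifs <;> simp

lemma coeff_vPos (f : D.EndBand c) {i : Fin (2 * D.t)} {r : ℕ} (hr : r < (D.v i).length)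
    (y : Fin D.w.length) : coeff (cycleT D.w (D.vPos i r)) y f =
      (if y = cycleT D.w (D.vPos i r) then
        coeff (cycleS D.w (D.vPos i r)) (cycleS D.w (D.vPos i r)) f else 0) +
      if y = D.twin (cycleT D.w (D.vPos i r)) then
        coeff (cycleS D.w (D.vPos i r)) (D.twin (cycleS D.w (D.vPos i r))) f else 0 := by
  have h := congrFun (end_arrowMap f (D.arr (D.vPos i r))
    (D.basisVec c (cycleS D.w (D.vPos i r)))) y
  rw [arrowMap_vPos D hr, arrowMap_vPos D hr, map_add, end_smul, end_smul, basisVec_apply,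
    if_pos rfl, basisVec_apply, if_neg (D.twin_ne (D.cycleS_mem hr)), one_smul, zero_smul,
    add_zero] at h
  rw [coeff_apply, h, band_add_apply, band_smul_apply, band_smul_apply, basisVec_apply,
    basisVec_apply]
  simp only [mul_ite, mul_one, mul_zero, coeff_apply]

lemma coeff_cyc (hc : c ≠ 0) (f : D.EndBand c) (p : Fin D.w.length) :
    coeff (cyc p) (cyc p) f = coeff p p f := by
  have h : coeff (cycleT D.w p) (cycleT D.w p) f = coeff (cycleS D.w p) (cycleS D.w p) f := by
    rcases D.isU_or_vPos p with hp | ⟨i, r, hr, rfl⟩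
    · rw [coeff_isU hc f hp, if_pos rfl]
    · rw [coeff_vPos f hr, if_pos rfl, if_neg (D.twin_ne (D.cycleT_mem hr)).symm, add_zero]
  cases hd : (D.w.get p).dir
  · rwa [D.cycle_t_inverse hd, D.cycle_s_inverse hd] at h
  · rw [D.cycle_t_direct hd, D.cycle_s_direct hd] at h
    exact h.symm

/-- The first vertex `a_0`. -/
def origin (D : WindWheel Q ρ) : Fin D.w.length := ⟨0, D.length_pos⟩

/-- By `coeff_cyc` neighbouring diagonal coefficients agree, and every vertex is reached from `a_0`
along the cycle. -/
lemma coeff_self (hc : c ≠ 0) (f : D.EndBand c) (p : Fin D.w.length) :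
    coeff p p f = coeff D.origin D.origin f := by
  obtain ⟨m, hm⟩ := p
  induction m with
  | zero => rfl
  | succ m ih =>
    rw [← ih (by omega), ← coeff_cyc hc f ⟨m, by omega⟩]
    have : cyc (⟨m, by omega⟩ : Fin D.w.length) = ⟨m + 1, hm⟩ := Fin.ext (Nat.mod_eq_of_lt hm)
    rw [this]

lemma coeff_twin_vPos (f : D.EndBand c) {i : Fin (2 * D.t)} {r : ℕ}
    (hr : r ≤ (D.v i).length) : coeff (D.vPos i r) (D.twin (D.vPos i r)) f =
      coeff (D.vPos i 0) (D.twin (D.vPos i 0)) f := by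
  induction r with
  | zero => rfl
  | succ r ih =>
    rw [← ih (by omega), ← cyc_vPos]
    have h := coeff_vPos f hr (D.twin (cycleT D.w (D.vPos i r)))
    rw [if_pos rfl, if_neg (D.twin_ne (D.cycleT_mem hr)), zero_add] at h
    cases hd : (D.w.get (D.vPos i r)).dir
    · rwa [D.cycle_t_inverse hd, D.cycle_s_inverse hd] at h
    · rw [D.cycle_t_direct hd, D.cycle_s_direct hd] at h
      exact h.symm

lemma coeff_twin_inverse (hc : c ≠ 0) (f : D.EndBand c) {i : Fin (2 * D.t)}
    (hi : IsInverse (D.v i)) {p : Fin D.w.length} (hp : p ∈ D.vSet i) :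
    coeff p (D.twin p) f = 0 := by
  obtain ⟨r, hr, rfl⟩ := D.mem_vSet.1 hp
  rw [coeff_twin_vPos f hr]
  -- The outside arrow ending at the first vertex forces the off-diagonal coefficient to vanish
  -- there, hence along the whole bar.
  obtain ⟨p, hp, h⟩ := D.exists_cycleT_eq_vPos_zero hi
  rw [← h, coeff_isU hc f hp, if_neg]
  rw [h]
  exact D.twin_ne (D.vPos_mem (Nat.zero_le _))

/-- An endomorphism without diagonal part. -/
lemma end_apply_of_coeff_eq_zero (hc : c ≠ 0) {f : D.EndBand c}
    (hf : coeff D.origin D.origin f = 0) (g : D.BandModule c) (q : Fin D.w.length) :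
    f g q = g (D.twin q) * coeff (D.twin q) q f := by
  rw [end_apply, Finset.sum_eq_single (D.twin q)]
  · intro p _ hp
    by_cases h : q = p
    · rw [h, coeff_self hc, hf, mul_zero]
    · rw [coeff_eq_zero f h, mul_zero]
      rintro rfl
      exact hp (D.twin_twin p).symm
  · simp

/-- Without diagonal part, the value at `q` comes only from `twin q`. For `q` in a direct bar this
lies in an inverse bar, where off-diagonal coefficients vanish: all values are supported on inverse
bars. -/
lemma end_apply_eq_zero (hc : c ≠ 0) {f : D.EndBand c}
    (hf : coeff D.origin D.origin f = 0) (g : D.BandModule c) {q : Fin D.w.length}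
    (hq : ∀ i, q ∈ D.vSet i → IsDirect (D.v i)) : f g q = 0 := by
  rw [end_apply_of_coeff_eq_zero hc hf]
  by_cases h : ∃ i, q ∈ D.vSet i
  · obtain ⟨i, h⟩ := h
    have := coeff_twin_inverse hc f (D.isInverse_σ (hq i h)) (D.twin_mem h)
    rw [twin_twin] at this
    rw [this, mul_zero]
  · rw [D.twin_of_notMem fun i hi => h ⟨i, hi⟩, coeff_self hc, hf, mul_zero]

/-- The values of `f'` live on inverse bars, whereas `f` sees only the coefficients on direct bars.
-/
lemma mul_eq_zero_of_coeff (hc : c ≠ 0) {f f' : D.EndBand c}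
    (hf : coeff D.origin D.origin f = 0) (hf' : coeff D.origin D.origin f' = 0) :
    f * f' = 0 := by
  refine LinearMap.ext fun g => funext fun q => ?_
  rw [Module.End.mul_apply]
  by_cases hq : ∀ i, q ∈ D.vSet i → IsDirect (D.v i)
  · exact end_apply_eq_zero hc hf _ hq
  · push Not at hq
    obtain ⟨i, hi, hd⟩ := hq
    rw [end_apply_of_coeff_eq_zero hc hf, end_apply_eq_zero hc hf', zero_mul]
    · rfl
    · intro j hj
      obtain rfl := D.vSet_disj (D.twin_mem hi) hj
      exact D.isDirect_σ ((D.v_serial i).resolve_left hd)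

/-- The diagonal coefficient, as an algebra homomorphism. -/
def diag (D : WindWheel Q ρ) (hc : c ≠ 0) : D.EndBand c →ₐ[k] k :=
  AlgHom.ofLinearMap (coeff D.origin D.origin)
    (by rw [coeff_apply, Module.End.one_apply, basisVec_apply, if_pos rfl])
    (by
      have h1 : coeff D.origin D.origin (1 : D.EndBand c) = 1 := by
        rw [coeff_apply, Module.End.one_apply, basisVec_apply, if_pos rfl]
      -- Splitting off scalars reduces multiplicativity to the vanishing of products of
      -- endomorphisms without diagonal part.
      have key : ∀ f : D.EndBand c, ∃ a : k, ∃ f₀ : D.EndBand c,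
          coeff D.origin D.origin f₀ = 0 ∧ f = a • 1 + f₀ := fun f =>
        ⟨coeff D.origin D.origin f, f - coeff D.origin D.origin f • 1, by
          rw [map_sub, map_smul, h1, smul_eq_mul, mul_one, sub_self], by abel⟩
      intro f f'
      obtain ⟨a, f₀, h, rfl⟩ := key f
      obtain ⟨b, f₁, h', rfl⟩ := key f'
      have e : (a • (1 : D.EndBand c) + f₀) * (b • 1 + f₁) =
          (a * b) • 1 + (a • f₁ + b • f₀) := by
        rw [add_mul, mul_add, mul_add, mul_eq_zero_of_coeff hc h h', smul_mul_smul_comm,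
          smul_mul_assoc, mul_smul_comm, one_mul, one_mul, mul_one, add_zero, add_assoc]
      rw [e]
      simp only [map_add, map_smul, h1, h, h', smul_eq_mul]
      ring)

/-! ### Construction of endomorphisms -/

/-- The linear map which exchanges the twins, with prescribed factors. -/
def twist (c : k) (β : Fin D.w.length → k) : Module.End k (D.BandModule c) where
  toFun g := fun q => β q * g (D.twin q)
  map_add' g h := funext fun q => mul_add (β q) (g (D.twin q)) (h (D.twin q))
  map_smul' a g := funext fun q => mul_left_comm (β q) a (g (D.twin q))

lemma twist_apply (β : Fin D.w.length → k) (g : D.BandModule c) (q : Fin D.w.length) :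
    twist c β g q = β q * g (D.twin q) := rfl

lemma twin_eq_iff {p q : Fin D.w.length} : D.twin p = q ↔ p = D.twin q := by
  constructor
  · rintro rfl; exact (D.twin_twin p).symm
  · rintro rfl; exact D.twin_twin q

/-- For an arrow outside the bars both composites vanish: `hS` kills what the arrow would read after
the twist, `hT` what the twist would read after the arrow. For a bar arrow the composites differ
only in where `β` is evaluated, and `hV` equates these values. -/
lemma twist_commute (β : Fin D.w.length → k)
    (hS : ∀ p, D.IsU p → β (cycleS D.w p) = 0)
    (hT : ∀ p, D.IsU p → β (D.twin (cycleT D.w p)) = 0)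
    (hV : ∀ i r, r < (D.v i).length →
      β (cycleS D.w (D.vPos i r)) = β (cycleT D.w (D.vPos i r)))
    (x : D.quiv.V ⊕ D.quiv.A) : twist c β * D.genMap c x = D.genMap c x * twist c β := by
  classical
  refine LinearMap.ext fun g => funext fun q => ?_
  rw [Module.End.mul_apply, Module.End.mul_apply, twist_apply]
  rcases x with x | α
  · simp only [genMap, Sum.elim_inl]
    have h : D.vtx (D.twin q) = D.vtx q := (D.vtx_eq.2 (Or.inr rfl)).symm
    rw [vertexMap_apply, vertexMap_apply, h, twist_apply]
    split_ifs <;> simp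
  · simp only [genMap, Sum.elim_inr]
    obtain ⟨p, rfl⟩ : ∃ p, D.arr p = α := Quot.exists_rep α
    rcases D.isU_or_vPos p with hp | ⟨i, r, hr, rfl⟩
    · rw [arrowMap_isU D hp, arrowMap_isU D hp, band_smul_apply, band_smul_apply, twist_apply,
        hS p hp, zero_mul, mul_zero, zero_mul, basisVec_apply]
      by_cases h : D.twin q = cycleT D.w p
      · rw [twin_eq_iff.1 h, hT p hp, zero_mul]
      · rw [if_neg h, mul_zero, mul_zero]
    · have h1 := hV i r hr
      have h2 := hV (D.σ i) ((D.v i).length - 1 - r) (by rw [length_v_σ]; omega)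
      change β (cycleS D.w (D.vTwin i r)) = β (cycleT D.w (D.vTwin i r)) at h2
      rw [D.cycleS_vTwin hr, D.cycleT_vTwin hr] at h2
      rw [arrowMap_vPos D hr, arrowMap_vPos D hr]
      simp only [band_add_apply, band_smul_apply, twist_apply, basisVec_apply, twin_twin,
        twin_eq_iff]
      have h3 := D.twin_ne (D.cycleT_mem hr)
      by_cases h4 : q = cycleT D.w (D.vPos i r)
      · subst h4
        rw [if_neg h3.symm, if_pos rfl, h1]
        ring
      · by_cases h5 : q = D.twin (cycleT D.w (D.vPos i r))
        · subst h5
          rw [if_neg h3, if_pos rfl, h2]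
          ring
        · rw [if_neg h4, if_neg h5]
          ring

open Classical in
/-- The factors on the inverse bars given by factors for the corresponding direct bars. -/
def barFactor (b : {i : Fin (2 * D.t) // IsDirect (D.v i)} → k) (q : Fin D.w.length) : k :=
  if h : ∃ i : {i : Fin (2 * D.t) // IsDirect (D.v i)}, q ∈ D.vSet (D.σ i) then
    b h.choose else 0

lemma barFactor_eq (b : {i : Fin (2 * D.t) // IsDirect (D.v i)} → k)
    (i : {i : Fin (2 * D.t) // IsDirect (D.v i)}) {q : Fin D.w.length}
    (hq : q ∈ D.vSet (D.σ i)) : barFactor b q = b i := by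
  have h : ∃ i : {i : Fin (2 * D.t) // IsDirect (D.v i)}, q ∈ D.vSet (D.σ i) := ⟨i, hq⟩
  rw [barFactor, dif_pos h]
  exact congrArg b (Subtype.ext (D.σ_invol.injective (D.vSet_disj h.choose_spec hq)))

lemma barFactor_eq_zero (b : {i : Fin (2 * D.t) // IsDirect (D.v i)} → k) {q : Fin D.w.length}
    (hq : ∀ i, q ∈ D.vSet i → ¬ IsInverse (D.v i)) : barFactor b q = 0 := by
  rw [barFactor, dif_neg]
  rintro ⟨i, hi⟩
  exact hq _ hi (D.isInverse_σ i.2)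

/-- The endomorphism mapping every direct bar to the corresponding inverse bar, with the given
factors. -/
def barEnd (c : k) (b : {i : Fin (2 * D.t) // IsDirect (D.v i)} → k) : D.EndBand c :=
  D.endOfCommute (twist c (barFactor b)) (twist_commute _
    (fun _ hp => barFactor_eq_zero b fun _ hi hinv => hp.cycleS_notMem hinv hi)
    (fun p hp => barFactor_eq_zero b fun i hi hinv => by
      have h := D.twin_mem hi
      rw [twin_twin] at h
      exact hp.cycleT_notMem (D.isDirect_σ hinv) h)
    -- Both factors vanish on a direct bar; on an inverse bar `v_i` both equal the factor `b` of the
    -- direct bar `v_{σ(i)}`.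
    (fun i r hr => by
      rcases D.v_serial i with hi | hi
      · rw [barFactor_eq_zero, barFactor_eq_zero]
        · intro j hj hinv
          obtain rfl := D.vSet_disj (D.cycleT_mem hr) hj
          exact D.not_isDirect hinv hi
        · intro j hj hinv
          obtain rfl := D.vSet_disj (D.cycleS_mem hr) hj
          exact D.not_isDirect hinv hi
      · rw [barFactor_eq b ⟨D.σ i, D.isDirect_σ hi⟩, barFactor_eq b ⟨D.σ i, D.isDirect_σ hi⟩]
        · rw [D.σ_invol]; exact D.cycleT_mem hr
        · rw [D.σ_invol]; exact D.cycleS_mem hr))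

lemma coeff_barEnd (b : {i : Fin (2 * D.t) // IsDirect (D.v i)} → k) (p q : Fin D.w.length) :
    coeff p q (barEnd c b) = barFactor b q * D.basisVec c p (D.twin q) := rfl

lemma coeff_barEnd_self (b : {i : Fin (2 * D.t) // IsDirect (D.v i)} → k)
    (p : Fin D.w.length) : coeff p p (barEnd c b) = 0 := by
  rw [coeff_barEnd, basisVec_apply]
  split_ifs with h
  · rw [barFactor_eq_zero b fun i hi => absurd h (D.twin_ne hi), zero_mul]
  · rw [mul_zero]

/-! ### The radical -/

/-- The coefficients of an endomorphism at the bars. -/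
def barCoeff (D : WindWheel Q ρ) (c : k) :
    D.EndBand c →ₗ[k] ({i : Fin (2 * D.t) // IsDirect (D.v i)} → k) :=
  LinearMap.pi fun i => coeff (D.vPos i 0) (D.twin (D.vPos i 0))

lemma barCoeff_apply (f : D.EndBand c) (i : {i : Fin (2 * D.t) // IsDirect (D.v i)}) :
    barCoeff D c f i = coeff (D.vPos i 0) (D.twin (D.vPos i 0)) f := rfl

lemma barCoeff_barEnd (b : {i : Fin (2 * D.t) // IsDirect (D.v i)} → k) :
    barCoeff D c (barEnd c b) = b := by
  funext i
  rw [barCoeff_apply, coeff_barEnd, twin_twin, basisVec_apply, if_pos rfl, mul_one,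
    barFactor_eq b i (D.twin_mem (D.vPos_mem (Nat.zero_le _)))]

lemma eq_zero_of_barCoeff (hc : c ≠ 0) {f : D.EndBand c} (h0 : D.diag hc f = 0)
    (h : barCoeff D c f = 0) : f = 0 := by
  refine LinearMap.ext fun g => funext fun q => ?_
  by_cases hq : ∀ i, q ∈ D.vSet i → IsDirect (D.v i)
  · exact end_apply_eq_zero hc h0 g hq
  · push Not at hq
    obtain ⟨i, hi, hd⟩ := hq
    have hd' := D.isDirect_σ ((D.v_serial i).resolve_left hd)
    rw [end_apply_of_coeff_eq_zero hc h0]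
    obtain ⟨r, hr, e⟩ := D.mem_vSet.1 (D.twin_mem hi)
    have h1 : coeff (D.twin q) q f = 0 := by
      -- This rewrites the coefficient from `twin q` to `q` as one from a vertex of a direct bar to
      -- its twin, so that it can be moved to the start of the bar.
      conv_lhs => rw [← D.twin_twin q, D.twin_twin (D.twin q), e]
      rw [coeff_twin_vPos f hr]
      exact congrFun h ⟨D.σ i, hd'⟩
    rw [h1, mul_zero]
    rfl

lemma mul_eq_zero_of_diag (hc : c ≠ 0) {f f' : D.EndBand c} (hf : D.diag hc f = 0)
    (hf' : D.diag hc f' = 0) : f * f' = 0 := mul_eq_zero_of_coeff hc hf hf'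

/-- If `x` in `N` were outside a maximal left ideal `m`, then `1 = y x + i` with `i` in `m`, and `(1
+ y x) i = 1 - (y x)² = 1` would lie in `m`. -/
lemma le_jacobson_of_mul_eq_zero {R : Type*} [Ring R] (N : Ideal R)
    (h : ∀ x ∈ N, ∀ y ∈ N, x * y = 0) : N ≤ Ring.jacobson R := by
  rw [Ring.jacobson_eq_sInf_isMaximal]
  refine le_sInf fun m (hm : m.IsMaximal) x hx => ?_
  by_contra hxm
  obtain ⟨y, i, hi, e⟩ := hm.exists_inv hxm
  have h1 : (1 + y * x) * i = 1 := by
    have h2 : (y * x) * (y * x) = 0 := h _ (N.mul_mem_left y hx) _ (N.mul_mem_left y hx)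
    rw [eq_sub_of_add_eq' e, mul_sub, mul_one, add_mul, one_mul, h2]
    abel
  exact hm.ne_top ((Ideal.eq_top_iff_one m).2 (h1 ▸ m.mul_mem_left _ hi))

lemma jacobson_eq_ker_diag (hc : c ≠ 0) :
    Ring.jacobson (D.EndBand c) = RingHom.ker (D.diag hc) := by
  apply le_antisymm
  · have : (RingHom.ker (D.diag hc)).IsMaximal :=
      RingHom.ker_isMaximal_of_surjective _ fun a => ⟨algebraMap k _ a, AlgHom.commutes _ a⟩
    exact Ring.jacobson_le_of_isMaximal _
  · exact le_jacobson_of_mul_eq_zero _ fun f hf f' hf' => mul_eq_zero_of_diag hc hf hf'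

lemma jacobson_sq (hc : c ≠ 0) : Ring.jacobson (D.EndBand c) ^ 2 = ⊥ := by
  rw [jacobson_eq_ker_diag hc, Submodule.pow_succ, Submodule.pow_one, eq_bot_iff,
    Submodule.mul_le]
  exact fun f hf f' hf' => mul_eq_zero_of_diag hc hf hf'

lemma rank_jacobson (hc : c ≠ 0) :
    Module.rank k ((Ring.jacobson (D.EndBand c)).restrictScalars k) = D.t := by
  classical
  rw [jacobson_eq_ker_diag hc]
  let ψ := (barCoeff D c) ∘ₗ ((RingHom.ker (D.diag hc)).restrictScalars k).subtype
  have hψ : Function.Bijective ψ := by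
    -- An element of the kernel of `diag` is determined by its bar coefficients, and `barEnd`
    -- realizes every prescribed family of them.
    constructor
    · rw [injective_iff_map_eq_zero]
      exact fun f hf => Subtype.ext (eq_zero_of_barCoeff hc f.2 hf)
    · exact fun b => ⟨⟨barEnd c b, coeff_barEnd_self b _⟩, barCoeff_barEnd b⟩
  rw [(LinearEquiv.ofBijective ψ hψ).rank_eq, rank_fun']
  have h := D.card_isDirect
  rw [Nat.card_eq_fintype_card] at h
  rw [h]

/-! ### Semisimple images -/

lemma arrowMap_basisVec_last {i : Fin (2 * D.t)} (hi : IsInverse (D.v i)) (α : D.quiv.A) :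
    D.arrowMap c α (D.basisVec c (D.vPos i (D.v i).length)) = 0 := by
  classical
  rw [arrowMap_apply]
  refine Finset.sum_eq_zero fun p _ => ?_
  rw [basisVec_apply, if_neg (D.cycleS_ne_vPos_last hi p), Pi.single_zero, smul_zero, ite_self]
  rfl

lemma vertexMap_basisVec (x : D.quiv.V) (p : Fin D.w.length) :
    ∃ a : k, D.vertexMap c x (D.basisVec c p) = a • D.basisVec c p := by
  classical
  refine ⟨if D.vtx p = x then 1 else 0, funext fun q => ?_⟩
  rw [vertexMap_apply, band_smul_apply, basisVec_apply]
  by_cases h : q = p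
  · subst h; simp
  · simp [h]

lemma smul_basisVec_last {i : Fin (2 * D.t)} (hi : IsInverse (D.v i)) (a : D.algebra k) :
    ∃ s : k, a • D.basisVec c (D.vPos i (D.v i).length) =
      s • D.basisVec c (D.vPos i (D.v i).length) := by
  refine D.action_induction (P := fun φ => ∃ s : k,
    φ (D.basisVec c (D.vPos i (D.v i).length)) = s • D.basisVec c (D.vPos i (D.v i).length))
    ?_ ?_ ?_ ?_ a
  · exact fun s => ⟨s, rfl⟩
  · rintro (x | α)
    · exact vertexMap_basisVec x _
    · exact ⟨0, by rw [zero_smul]; exact arrowMap_basisVec_last hi α⟩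
  · rintro φ ψ ⟨s, h⟩ ⟨s', h'⟩
    exact ⟨s' * s, by rw [Module.End.mul_apply, h', map_smul, h, smul_smul]⟩
  · rintro φ ψ ⟨s, h⟩ ⟨s', h'⟩
    exact ⟨s + s', by rw [LinearMap.add_apply, h, h', add_smul]⟩

lemma basisVec_ne_zero (p : Fin D.w.length) : D.basisVec c p ≠ 0 := by
  intro h
  have := congrFun h p
  rw [basisVec_apply, if_pos rfl] at this
  exact one_ne_zero this

/-- A semisimple submodule of the band module does not contain the basis vector next to the socle of
an inverse bar. -/
lemma basisVec_notMem_of_isSemisimple {i : Fin (2 * D.t)} (hi : IsInverse (D.v i))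
    (S : Submodule (D.algebra k) (D.BandModule c)) [IsSemisimpleModule (D.algebra k) S] :
    D.basisVec c (D.vPos i ((D.v i).length - 1)) ∉ S := by
  intro hx
  have h0 := D.v_pos i
  have hr : (D.v i).length - 1 < (D.v i).length := by omega
  let α : D.algebra k := D.gen (Sum.inr (D.arr (D.vPos i ((D.v i).length - 1))))
  have hα : α • D.basisVec c (D.vPos i ((D.v i).length - 1)) =
      D.basisVec c (D.vPos i (D.v i).length) := by
    have hd : (D.w.get (D.vPos i ((D.v i).length - 1))).dir = false := by
      rw [D.get_vPos hr]
      exact hi _ (List.getElem_mem _)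
    rw [D.gen_smul]
    refine (D.arrowMap_vPos hr _).trans ?_
    rw [D.cycle_s_inverse hd, D.cycle_t_inverse hd, cyc_vPos, basisVec_apply, if_pos rfl,
      basisVec_apply, if_neg (D.twin_ne (D.vPos_mem hr.le)), one_smul, zero_smul, add_zero,
      Nat.sub_add_cancel h0]
  have hz : D.basisVec c (D.vPos i (D.v i).length) ∈ S := hα ▸ S.smul_mem α hx
  let z : S := ⟨_, hz⟩
  have : ComplementedLattice (Submodule (D.algebra k) S) :=
    ‹IsSemisimpleModule (D.algebra k) S›.toComplementedLattice
  -- Write `x = a z + y'` with `y'` in a complement `C` of the submodule generated by `z = α x`.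
  -- Since `α` kills the line of `z`, which contains `a z`, it follows that `z = α y'` lies in `C`,
  -- so `z = 0`.
  obtain ⟨C, hC⟩ := exists_isCompl (Submodule.span (D.algebra k) {z})
  obtain ⟨y, hy, y', hy', e⟩ := Submodule.mem_sup.1
    (hC.sup_eq_top ▸ Submodule.mem_top : (⟨_, hx⟩ : S) ∈ Submodule.span (D.algebra k) {z} ⊔ C)
  obtain ⟨a, rfl⟩ := Submodule.mem_span_singleton.1 hy
  have h1 : α • (a • z) = 0 := by
    refine Subtype.ext ?_
    obtain ⟨s, hs⟩ := smul_basisVec_last (c := c) hi a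
    change α • (a • D.basisVec c (D.vPos i (D.v i).length)) = 0
    rw [hs, D.gen_smul, map_smul]
    exact (congrArg _ (arrowMap_basisVec_last hi _)).trans (smul_zero s)
  have h2 : z = α • y' := by
    rw [← zero_add (α • y'), ← h1, ← smul_add, e]
    exact Subtype.ext hα.symm
  have h3 : z ∈ Submodule.span (D.algebra k) {z} ⊓ C :=
    ⟨Submodule.mem_span_singleton_self z, h2 ▸ C.smul_mem α hy'⟩
  rw [hC.inf_eq_bot] at h3
  exact basisVec_ne_zero _ (congrArg Subtype.val ((Submodule.mem_bot _).1 h3))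

lemma exists_isInverse (D : WindWheel Q ρ) : ∃ i, IsInverse (D.v i) := by
  have i : Fin (2 * D.t) := ⟨0, by have := D.t_pos; omega⟩
  rcases D.v_serial i with h | h
  · exact ⟨_, D.isInverse_σ h⟩
  · exact ⟨i, h⟩

lemma range_eq_top_of_diag_ne_zero (hc : c ≠ 0) {f : D.EndBand c} (h : D.diag hc f ≠ 0) :
    LinearMap.range f = ⊤ := by
  set a := D.diag hc f with ha
  have h0 : D.diag hc (f - a • 1) = 0 := by
    rw [map_sub, map_smul, map_one, smul_eq_mul, mul_one, sub_self]
  -- With `f = a + f₀` and `f₀² = 0`, one has `(a + f₀)(a - f₀) = a²`.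
  have h1 : f * ((a * a)⁻¹ • (a • 1 - (f - a • 1))) = 1 := by
    have h2 := mul_eq_zero_of_diag hc h0 h0
    have h3 : f * (a • 1 - (f - a • 1)) = (a * a) • 1 := by
      obtain ⟨f₀, hf₀⟩ : ∃ f₀, f₀ = f - a • 1 := ⟨_, rfl⟩
      rw [← hf₀] at h2 ⊢
      rw [eq_add_of_sub_eq' hf₀.symm, add_mul, mul_sub, mul_sub, h2, smul_mul_smul_comm,
        mul_smul_comm, smul_mul_assoc, one_mul, mul_one, one_mul]
      abel
    rw [mul_smul_comm, h3, smul_smul, inv_mul_cancel₀ (mul_ne_zero h h), one_smul]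
  rw [LinearMap.range_eq_top]
  exact fun x => ⟨_, LinearMap.congr_fun h1 x⟩

lemma end_basisVec (hc : c ≠ 0) {f : D.EndBand c} (h0 : D.diag hc f = 0)
    {i : Fin (2 * D.t)} {r : ℕ} (hr : r ≤ (D.v i).length) :
    f (D.basisVec c (D.vPos i r)) = coeff (D.vPos i 0) (D.twin (D.vPos i 0)) f •
      D.basisVec c (D.twin (D.vPos i r)) := by
  funext q
  rw [end_apply_of_coeff_eq_zero hc h0, band_smul_apply, basisVec_apply, basisVec_apply,
    ← coeff_twin_vPos f hr]
  by_cases h : q = D.twin (D.vPos i r)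
  · subst h
    rw [twin_twin, if_pos rfl, if_pos rfl, mul_comm]
  · rw [if_neg fun e => h (twin_eq_iff.1 e), if_neg h, zero_mul, mul_zero]

lemma eq_zero_of_isSemisimple_range (hc : c ≠ 0) (f : D.EndBand c)
    (hf : IsSemisimpleModule (D.algebra k) (LinearMap.range f)) : f = 0 := by
  have h0 : D.diag hc f = 0 := by
    by_contra h
    obtain ⟨i, hi⟩ := D.exists_isInverse
    exact basisVec_notMem_of_isSemisimple hi (LinearMap.range f)
      (range_eq_top_of_diag_ne_zero hc h ▸ Submodule.mem_top)
  refine eq_zero_of_barCoeff hc h0 (funext fun i => ?_)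
  by_contra h
  refine basisVec_notMem_of_isSemisimple (D.isInverse_σ i.2) (LinearMap.range f)
    -- The twin of the vertex `1` of the direct bar is the last but one vertex of the inverse bar
    -- `v_{σ(i)}`; it exists because bars have length at least `1`.
    ⟨(barCoeff D c f i)⁻¹ • D.basisVec c (D.vPos i 1), ?_⟩
  have h1 : 1 ≤ (D.v i).length := D.v_pos i
  rw [end_smul, end_basisVec hc h0 h1, ← barCoeff_apply, smul_smul, inv_mul_cancel₀ h, one_smul,
    D.twin_vPos h1, length_v_σ]

end

end WindWheel

end WindWheels

theorem mainTheorem11 {k : Type*} [Field k] {Q : WindWheels.Quiv} {ρ : Set (List Q.A)}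
    (D : WindWheels.WindWheel Q ρ) (c : k) (hc : c ≠ 0) :
    Ring.jacobson (D.EndBand c) ^ 2 = ⊥ ∧
    Module.rank k ((Ring.jacobson (D.EndBand c)).restrictScalars k) = D.t ∧
    ∀ f : D.EndBand c, IsSemisimpleModule (D.algebra k) (LinearMap.range f) → f = 0 := by
  exact ⟨WindWheels.WindWheel.jacobson_sq hc, WindWheels.WindWheel.rank_jacobson hc,
    WindWheels.WindWheel.eq_zero_of_isSemisimple_range hc⟩
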